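/- Let $a$ be a nonzero integer. For a positive integer $n$ relatively prime to $a$ put $H_2(a;n)=\{(x,y)\in\mathbb Z^2 : xy\equiv a \bmod n,\ 1\le x,y<n\}$, let $S(a;n)=\{x+y:(x,y)\in H_2(a;n)\}$ and $D(a;n)=\{x-y:(x,y)\in H_2(a;n)\}$ (sets of integers), and let $\bar S_2(a;n)$, $\bar D_2(a;n)\subseteq \mathbb Z/n\mathbb Z$ be their reductions modulo $n$. For $n\ge 2$ put $c_2(a;n)=\#\bar S_2(a;n)/\#\bar D_2(a;n)$. Then, with $n$ running through the positive integers relatively prime to $a$: (1) there is a constant $C>0$, which may depend on $a$, such that for all such $n\ge 3$ $$\frac{1}{\log\log n}\le C\,c_2(a;n)\quad\text{and}\quad c_2(a;n)\le C\log\log n;$$ (2) $\limsup_{n\to\infty} c_2(a;n)=\infty$ and $\liminf_{n\to\infty} c_2(a;n)=0$; (3) $\limsup_{n\to\infty} \#S(a;n)/\#D(a;n)=\infty$ and $\liminf_{n\to\infty} \#S(a;n)/\#D(a;n)=0$. -/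

import Mathlib

/-- The modular hyperbola `H₂(a;n) = {(x, y) : xy ≡ a mod n, 1 ≤ x, y < n}`. -/
noncomputable def modHyperbola (a : ℤ) (n : ℕ) : Finset (ℤ × ℤ) :=
  (Finset.Ico (1 : ℤ) n ×ˢ Finset.Ico (1 : ℤ) n).filter fun p => p.1 * p.2 ≡ a [ZMOD n]

/-- The (unreduced) coordinate sumset `S₂(a;n)`, a set of integers. -/
noncomputable def coordSumset (a : ℤ) (n : ℕ) : Finset ℤ :=
  (modHyperbola a n).image fun p => p.1 + p.2

/-- The (unreduced) coordinate difference set `D₂(a;n)`, a set of integers. -/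
noncomputable def coordDiffset (a : ℤ) (n : ℕ) : Finset ℤ :=
  (modHyperbola a n).image fun p => p.1 - p.2

/-- The reduced coordinate sumset: the residues modulo `n` of `x + y`, `(x, y) ∈ H₂(a;n)`. -/
noncomputable def redSumset (a : ℤ) (n : ℕ) : Finset (ZMod n) :=
  (modHyperbola a n).image fun p => ((p.1 + p.2 : ℤ) : ZMod n)

/-- The reduced coordinate difference set: the residues modulo `n` of `x - y`,
`(x, y) ∈ H₂(a;n)`. -/
noncomputable def redDiffset (a : ℤ) (n : ℕ) : Finset (ZMod n) :=
  (modHyperbola a n).image fun p => ((p.1 - p.2 : ℤ) : ZMod n)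

/-- The ratio `c₂(a;n)` of the sizes of the reduced sumset and the reduced difference set. For
`n ≥ 2` coprime to `a` both sets are nonempty. -/
noncomputable def redRatio (a : ℤ) (n : ℕ) : ℝ :=
  ((redSumset a n).card : ℝ) / ((redDiffset a n).card : ℝ)

/-- The unreduced ratio `#S₂(a;n) / #D₂(a;n)`. For `n ≥ 2` coprime to `a` both sets are
nonempty. -/
noncomputable def unredRatio (a : ℤ) (n : ℕ) : ℝ :=
  ((coordSumset a n).card : ℝ) / ((coordDiffset a n).card : ℝ)

/-- The filter describing `n → ∞` with `n` restricted to the positive integers coprime to `a`. -/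
noncomputable def coprimeAtTop (a : ℤ) : Filter ℕ :=
  Filter.atTop ⊓ Filter.principal {n : ℕ | 0 < n ∧ IsCoprime a (n : ℤ)}

/-! ### Mertens' theorems for primes congruent to 3 modulo 4. -/

section PrimeSums

open Finset ArithmeticFunction

/-! A difference `x - y` with `xy = a` is a sum `x + y'` with `xy' = -a`, so `redRatio a n` is
`hypCount n a / hypCount n (-a)`. By the Chinese remainder theorem both counts are multiplicative in
`n`, and everything reduces to prime powers.

If `p ≡ 1 mod 4`, then `-1` is a square modulo `p ^ k` and the two counts agree. For `p = 2, 3`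
their ratio is bounded. If `p ≡ 3 mod 4` and `p ≥ 7`, the map `x ↦ x + a / x` is two-to-one on the
units with `x² ≢ a mod p`. Exactly one of `a`, `-a` is a square modulo `p`, so the numbers of such
units for `a` and `-a` differ by a relative amount `O(1 / p)`, and the local ratio is at most `exp
(2 / p + 12 / p ^ 2)` (`hypCount_prime_pow_le`). By Mertens for this progression, the sum of `2 / p`
over `p ≤ log n` is `log log log n + O(1)`; at most `log n / log 2` primes divide `n`, so those
above `log n` add only `O(1)`. Exponentiating gives the upper bound, and replacing `a` by `-a` the
lower one.

For unboundedness, each such `p` not dividing `a` has an exponent `k ∈ {1, 2}` at which the ratio is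
at least `1 + 1 / p` (`exists_prime_pow_le_hypCount`). The product over many primes exceeds `1 + ∑ 1
/ p`, which is unbounded; `-a` gives the liminf. Unreduced sums and differences lie in intervals of
length `2 n`, so reduction changes each cardinality by at most a factor 2. -/

/-- The nontrivial character modulo 4, as a real-valued function on the naturals. -/
def chiFour (n : ℕ) : ℝ := ((ZMod.χ₄ (n : ZMod 4) : ℤ) : ℝ)

lemma chiFour_mul (m n : ℕ) : chiFour (m * n) = chiFour m * chiFour n := by
  simp only [chiFour, Nat.cast_mul, map_mul, Int.cast_mul]

lemma chiFour_eq (n : ℕ) :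
    chiFour n = if n % 4 = 1 then 1 else if n % 4 = 3 then -1 else 0 := by
  unfold chiFour
  rw [ZMod.χ₄_nat_eq_if_mod_four]
  have := Nat.mod_lt n (show 0 < 4 by norm_num)
  split_ifs <;> first | (exfalso; omega) | simp

lemma abs_chiFour_le_one (n : ℕ) : |chiFour n| ≤ 1 := by
  rw [chiFour_eq]; split_ifs <;> simp

lemma sum_chiFour (N : ℕ) :
    ∑ n ∈ Ioc 0 N, chiFour n = if N % 4 = 1 ∨ N % 4 = 2 then 1 else 0 := by
  induction N with
  | zero => simp
  | succ N ih =>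
    rw [sum_Ioc_succ_top (Nat.zero_le N), ih, chiFour_eq]
    have := Nat.mod_lt N (show 0 < 4 by norm_num)
    split_ifs <;> first | (exfalso; omega) | norm_num

lemma abs_sum_Ioc_chiFour_le_one {M N : ℕ} (h : M ≤ N) : |∑ n ∈ Ioc M N, chiFour n| ≤ 1 := by
  have := sum_Ioc_consecutive chiFour (Nat.zero_le M) h
  rw [sum_chiFour, sum_chiFour] at this
  rw [abs_le]
  split_ifs at this <;> constructor <;> linarith

/-- Partial summation against `chiFour` for a nonnegative antitone weight. -/
lemma abs_sum_chiFour_mul_le (h : ℕ → ℝ) (M : ℕ) (h0 : ∀ n, 0 ≤ h n)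
    (hanti : ∀ n, M < n → h (n + 1) ≤ h n) {N : ℕ} (hMN : M ≤ N) :
    |∑ n ∈ Ioc M N, chiFour n * h n| ≤ h (M + 1) := by
  -- Abel summation: once the boundary term is removed, each step adds a partial character sum,
  -- bounded by 1, times a decrement of `h`, and the decrements telescope.
  have key : |∑ n ∈ Ioc M N, chiFour n * h n - (∑ n ∈ Ioc M N, chiFour n) * h (N + 1)|
      ≤ h (M + 1) - h (N + 1) := by
    induction N, hMN using Nat.le_induction with
    | base => simp
    | succ N hN ih =>
      have hX := abs_sum_Ioc_chiFour_le_one (show M ≤ N + 1 by omega)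
      have hd := hanti (N + 1) (by omega)
      rw [sum_Ioc_succ_top hN] at hX
      rw [sum_Ioc_succ_top hN, sum_Ioc_succ_top hN]
      set E := ∑ n ∈ Ioc M N, chiFour n * h n
      set X := ∑ n ∈ Ioc M N, chiFour n
      have e : E + chiFour (N + 1) * h (N + 1) - (X + chiFour (N + 1)) * h (N + 1 + 1)
          = (E - X * h (N + 1)) + (X + chiFour (N + 1)) * (h (N + 1) - h (N + 1 + 1)) := by ring
      rw [e]
      refine (abs_add_le _ _).trans ?_
      rw [abs_mul, abs_of_nonneg (show 0 ≤ h (N + 1) - h (N + 1 + 1) by linarith)]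
      nlinarith
  have hX := abs_sum_Ioc_chiFour_le_one hMN
  have h1 : |(∑ n ∈ Ioc M N, chiFour n) * h (N + 1)| ≤ h (N + 1) := by
    rw [abs_mul, abs_of_nonneg (h0 (N + 1))]
    nlinarith [h0 (N + 1)]
  rw [abs_le] at *
  constructor <;> linarith [key.1, key.2, h1.1, h1.2]

lemma sum_vonMangoldt_le (N : ℕ) :
    ∑ n ∈ Ioc 0 N, Λ n ≤ (Real.log 4 + 4) * N := by
  have := Chebyshev.psi_le_const_mul_self (x := N) (by positivity)
  simpa [Chebyshev.psi] using this

lemma sum_log_eq_sum_vonMangoldt (N : ℕ) :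
    ∑ n ∈ Ioc 0 N, Real.log n = ∑ d ∈ Ioc 0 N, Λ d * ((N / d : ℕ) : ℝ) := by
  rw [← sum_Ioc_mul_zeta_eq_sum, vonMangoldt_mul_zeta]
  simp [log_apply]

lemma sum_log_le (N : ℕ) : ∑ n ∈ Ioc 0 N, Real.log n ≤ N * Real.log N := by
  have := sum_le_card_nsmul (Ioc 0 N) (fun n : ℕ => Real.log n) (Real.log N) (fun n hn => by
    rw [mem_Ioc] at hn
    exact Real.log_le_log (by exact_mod_cast hn.1) (by exact_mod_cast hn.2))
  simpa using this

lemma le_sum_log (N : ℕ) : N * Real.log N - N ≤ ∑ n ∈ Ioc 0 N, Real.log n := by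
  induction N with
  | zero => simp
  | succ N ih =>
    rw [sum_Ioc_succ_top (Nat.zero_le N)]
    rcases Nat.eq_zero_or_pos N with rfl | hN
    · simp
    have hN' : (0 : ℝ) < N := by exact_mod_cast hN
    have : N * (Real.log (N + 1) - Real.log N) ≤ 1 := by
      rw [← Real.log_div (by positivity) (by positivity)]
      have := Real.log_le_sub_one_of_pos (show 0 < ((N : ℝ) + 1) / N by positivity)
      have e : ((N : ℝ) + 1) / N - 1 = 1 / N := by field_simp; ring
      rw [e] at this
      calc _ ≤ (N : ℝ) * (1 / N) := by gcongr
        _ = 1 := by field_simp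
    push_cast
    linarith

/-- Mertens' first theorem, upper bound. -/
lemma sum_vonMangoldt_div_le {N : ℕ} (hN : 0 < N) :
    ∑ d ∈ Ioc 0 N, Λ d / d ≤ Real.log N + (Real.log 4 + 4) := by
  have hN' : (0 : ℝ) < N := by exact_mod_cast hN
  have h : N * ∑ d ∈ Ioc 0 N, Λ d / d ≤ ∑ d ∈ Ioc 0 N, (Λ d * ((N / d : ℕ) : ℝ) + Λ d) := by
    rw [mul_sum]
    refine sum_le_sum fun d hd => ?_
    rw [mem_Ioc] at hd
    have hd' : (0 : ℝ) < d := by exact_mod_cast hd.1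
    have h1 : (N : ℝ) / d ≤ ((N / d : ℕ) : ℝ) + 1 := by
      rw [← Nat.floor_div_eq_div (K := ℝ)]; exact (Nat.lt_floor_add_one _).le
    calc (N : ℝ) * (Λ d / d) = Λ d * (N / d) := by ring
      _ ≤ Λ d * (((N / d : ℕ) : ℝ) + 1) := by gcongr
      _ = _ := by ring
  rw [sum_add_distrib, ← sum_log_eq_sum_vonMangoldt] at h
  have := sum_vonMangoldt_le N
  have := sum_log_le N
  refine le_of_mul_le_mul_left (a := (N : ℝ)) ?_ hN'
  linarith

/-- Mertens' first theorem, lower bound. -/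
lemma le_sum_vonMangoldt_div {N : ℕ} (hN : 0 < N) :
    Real.log N - 1 ≤ ∑ d ∈ Ioc 0 N, Λ d / d := by
  have hN' : (0 : ℝ) < N := by exact_mod_cast hN
  have h : ∑ d ∈ Ioc 0 N, Λ d * ((N / d : ℕ) : ℝ) ≤ N * ∑ d ∈ Ioc 0 N, Λ d / d := by
    rw [mul_sum]
    refine sum_le_sum fun d hd => ?_
    calc Λ d * ((N / d : ℕ) : ℝ) ≤ Λ d * (N / d) := by
          gcongr
          exact Nat.cast_div_le
      _ = _ := by ring
  rw [← sum_log_eq_sum_vonMangoldt] at h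
  have := le_sum_log N
  refine le_of_mul_le_mul_left (a := (N : ℝ)) ?_ hN'
  linarith

lemma abs_sum_chiFour_div_sub_le {M N : ℕ} (h : M ≤ N) :
    |∑ m ∈ Ioc 0 N, chiFour m / m - ∑ m ∈ Ioc 0 M, chiFour m / m| ≤ 1 / (M + 1) := by
  rw [← sum_Ioc_consecutive _ (Nat.zero_le M) h, add_sub_cancel_left]
  have := abs_sum_chiFour_mul_le (fun n => 1 / (n : ℝ)) M (fun n => by positivity)
    (fun n hn => by
      have : (0 : ℝ) < n := by exact_mod_cast (by omega : 0 < n)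
      push_cast
      gcongr
      linarith) h
  simpa [div_eq_mul_inv] using this

/-- This is the nonvanishing of `L(1, χ₄)`: the alternating series starts with 1, and the remainder
after `M = 1` is at most `1 / 2`. -/
lemma half_le_sum_chiFour_div {N : ℕ} (h : 1 ≤ N) :
    1 / 2 ≤ ∑ m ∈ Ioc 0 N, chiFour m / m := by
  have := abs_sum_chiFour_div_sub_le h
  have e : ∑ m ∈ Ioc 0 1, chiFour m / m = 1 := by
    rw [show Ioc 0 1 = {1} from rfl]; simp [chiFour_eq]
  rw [e, abs_le] at this
  have := this.1
  norm_num at this ⊢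
  linarith

lemma abs_sum_chiFour_mul_log_div_le :
    ∃ C : ℝ, ∀ N : ℕ, |∑ n ∈ Ioc 0 N, chiFour n * (Real.log n / n)| ≤ C := by
  refine ⟨Real.log 2 / 2 + Real.log 3 / 3, fun N => ?_⟩
  -- `log n / n` decreases only from `e` on, so partial summation starts at 3; the terms `n = 1, 2`
  -- vanish.
  have tail : ∀ N : ℕ, 2 ≤ N →
      |∑ n ∈ Ioc 2 N, chiFour n * (Real.log n / n)| ≤ Real.log 3 / 3 := by
    intro N hN
    have := abs_sum_chiFour_mul_le (fun n : ℕ => Real.log n / n) 2 (fun n => by positivity)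
      (fun n hn => by
        have h3 : (3 : ℝ) ≤ n := by exact_mod_cast hn
        have he : Real.exp 1 ≤ n := by linarith [Real.exp_one_lt_d9]
        push_cast
        exact Real.log_div_self_antitoneOn he (by simp only [Set.mem_Ici]; linarith) (by linarith)) hN
    simpa using this
  have l2 : 0 ≤ Real.log 2 / 2 := by positivity
  have l3 : 0 ≤ Real.log 3 / 3 := by positivity
  rcases le_or_gt N 2 with h | h
  · interval_cases N <;> simp [sum_Ioc_succ_top, chiFour_eq] <;> positivity
  · rw [← sum_Ioc_consecutive _ (Nat.zero_le 2) h.le]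
    have := tail N h.le
    have e : ∑ n ∈ Ioc 0 2, chiFour n * (Real.log n / n) = 0 := by
      simp [sum_Ioc_succ_top, chiFour_eq]
    rw [e, zero_add]
    linarith

/-- The sum of `chiFour d * Λ d / d` is bounded (Mertens' argument). -/
lemma abs_sum_chiFour_vonMangoldt_div_le :
    ∃ C : ℝ, ∀ N : ℕ, |∑ d ∈ Ioc 0 N, chiFour d * Λ d / d| ≤ C := by
  obtain ⟨C, hC⟩ := abs_sum_chiFour_mul_log_div_le
  refine ⟨2 * (C + (Real.log 4 + 4)), fun N => ?_⟩
  have hC0 : 0 ≤ C := (abs_nonneg _).trans (hC 0)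
  rcases Nat.eq_zero_or_pos N with rfl | hN
  · simp; positivity
  have hN' : (0 : ℝ) < N := by exact_mod_cast hN
  let f : ArithmeticFunction ℝ := ⟨fun d => chiFour d * Λ d / d, by simp⟩
  let g : ArithmeticFunction ℝ := ⟨fun m => chiFour m / m, by simp⟩
  -- Complete multiplicativity of the character turns `Λ * 1 = log` into its twisted form.
  have hfg : ∀ n ∈ Ioc 0 N, (f * g) n = chiFour n * (Real.log n / n) := by
    intro n hn
    rw [mul_apply, ← vonMangoldt_sum, ← Nat.sum_divisorsAntidiagonal (fun d _ => Λ d), sum_div,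
      mul_sum]
    refine sum_congr rfl fun x hx => ?_
    rw [Nat.mem_divisorsAntidiagonal] at hx
    change chiFour x.1 * Λ x.1 / x.1 * (chiFour x.2 / x.2) = _
    rw [← hx.1, chiFour_mul]
    push_cast
    field_simp
  have hsum := sum_Ioc_mul_eq_sum_sum f g N
  rw [sum_congr rfl hfg] at hsum
  set G : ℕ → ℝ := fun M => ∑ m ∈ Ioc 0 M, chiFour m / m with hG
  have hsum' : ∑ n ∈ Ioc 0 N, chiFour n * (Real.log n / n)
      = ∑ d ∈ Ioc 0 N, chiFour d * Λ d / d * G (N / d) := hsum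
  -- Replacing `G (N / d)` by `G N` costs at most `d / N` per term; the factor `d` cancels the
  -- denominator, and Chebyshev's bound controls the total.
  have hdiff : |∑ d ∈ Ioc 0 N, chiFour d * Λ d / d * (G N - G (N / d))|
      ≤ Real.log 4 + 4 := by
    calc _ ≤ ∑ d ∈ Ioc 0 N, |chiFour d * Λ d / d * (G N - G (N / d))| := abs_sum_le_sum_abs _ _
      _ ≤ ∑ d ∈ Ioc 0 N, Λ d * (1 / N) := by
        refine sum_le_sum fun d hd => ?_
        rw [mem_Ioc] at hd
        have hd' : (0 : ℝ) < d := by exact_mod_cast hd.1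
        have h1 := abs_sum_chiFour_div_sub_le (Nat.div_le_self N d)
        have h2 : 1 / (((N / d : ℕ) : ℝ) + 1) ≤ d / N := by
          rw [div_le_div_iff₀ (by positivity) hN', ← div_le_iff₀' hd', one_mul,
            ← Nat.floor_div_eq_div (K := ℝ)]
          exact (Nat.lt_floor_add_one _).le
        rw [abs_mul, abs_div, abs_mul, abs_of_nonneg (vonMangoldt_nonneg (n := d)),
          abs_of_pos hd']
        calc |chiFour d| * Λ d / d * |G N - G (N / d)| ≤ 1 * Λ d / d * (d / N) := by
              have := abs_chiFour_le_one d
              have := vonMangoldt_nonneg (n := d)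
              gcongr
              exact h1.trans h2
          _ = Λ d * (1 / N) := by field_simp
      _ = (∑ d ∈ Ioc 0 N, Λ d) / N := by rw [← sum_mul]; ring
      _ ≤ _ := by rw [div_le_iff₀ hN']; exact sum_vonMangoldt_le N
  have e : (∑ d ∈ Ioc 0 N, chiFour d * Λ d / d) * G N
      = ∑ n ∈ Ioc 0 N, chiFour n * (Real.log n / n)
        + ∑ d ∈ Ioc 0 N, chiFour d * Λ d / d * (G N - G (N / d)) := by
    rw [hsum', ← sum_add_distrib, sum_mul]
    exact sum_congr rfl fun d _ => by ring
  have hb : |(∑ d ∈ Ioc 0 N, chiFour d * Λ d / d) * G N| ≤ C + (Real.log 4 + 4) := by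
    rw [e]; exact (abs_add_le _ _).trans (add_le_add (hC N) hdiff)
  have hGN : 1 / 2 ≤ G N := half_le_sum_chiFour_div hN
  rw [abs_mul, abs_of_pos (by linarith : 0 < G N)] at hb
  nlinarith [abs_nonneg (∑ d ∈ Ioc 0 N, chiFour d * Λ d / d)]

/-- `2 log p / p` for primes `p ≡ 3 mod 4`, and `0` elsewhere. -/
noncomputable def logWeight (n : ℕ) : ℝ :=
  if n.Prime ∧ n % 4 = 3 then 2 * Real.log n / n else 0

/-- The factor `1 - chiFour n` is 2 on the class 3 modulo 4 and 0 on the class 1; the remaining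
terms, from 2 and from higher prime powers, are nonnegative. -/
lemma logWeight_le (n : ℕ) : logWeight n ≤ Λ n / n - chiFour n * Λ n / n := by
  have h := abs_le.1 (abs_chiFour_le_one n)
  unfold logWeight
  split_ifs with hn
  · rw [vonMangoldt_apply_prime hn.1, chiFour_eq, if_neg (by omega), if_pos hn.2]
    apply le_of_eq; ring
  · have : Λ n / n - chiFour n * Λ n / n = (1 - chiFour n) * (Λ n / n) := by ring
    rw [this]
    exact mul_nonneg (by linarith) (div_nonneg vonMangoldt_nonneg (by positivity))

lemma sum_logWeight_le : ∃ C : ℝ, ∀ N : ℕ, 0 < N →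
    ∑ n ∈ Ioc 0 N, logWeight n ≤ Real.log N + C := by
  obtain ⟨C, hC⟩ := abs_sum_chiFour_vonMangoldt_div_le
  refine ⟨Real.log 4 + 4 + C, fun N hN => ?_⟩
  have h := sum_le_sum fun n (_ : n ∈ Ioc 0 N) => logWeight_le n
  rw [sum_sub_distrib] at h
  have := (abs_le.1 (hC N)).1
  have := sum_vonMangoldt_div_le hN
  linarith

lemma le_sum_logWeight : ∃ C : ℝ, ∀ N : ℕ, 0 < N →
    Real.log N - C ≤ ∑ n ∈ Ioc 0 N, logWeight n := by
  obtain ⟨C, hC⟩ := abs_sum_chiFour_vonMangoldt_div_le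
  have hs : Summable fun n : ℕ => (if n.Prime then 0 else Λ n) / (n : ℝ) := by
    -- The residue class modulo 1 is everything, so this is the convergence of the sum over all
    -- proper prime powers.
    refine (vonMangoldt.summable_residueClass_non_primes_div (0 : ZMod 1)).congr fun n => ?_
    rw [show vonMangoldt.residueClass (0 : ZMod 1) n = Λ n from
      Set.indicator_of_mem (s := {n : ℕ | (n : ZMod 1) = 0}) (Subsingleton.elim _ _) _]
  set K := ∑' n : ℕ, (if n.Prime then 0 else Λ n) / (n : ℝ)
  refine ⟨1 + C + 2 * K + Real.log 2, fun N hN => ?_⟩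
  have hle : ∀ n ∈ Ioc 0 N, Λ n / n - chiFour n * Λ n / n ≤ logWeight n
      + 2 * ((if n.Prime then 0 else Λ n) / (n : ℝ)) + (if n = 2 then Real.log 2 else 0) := by
    intro n hn
    have h := abs_le.1 (abs_chiFour_le_one n)
    have hL : 0 ≤ Λ n / n := div_nonneg vonMangoldt_nonneg (by positivity)
    have e : Λ n / n - chiFour n * Λ n / n = (1 - chiFour n) * (Λ n / n) := by ring
    rw [e]
    by_cases hp : n.Prime
    · rcases hp.eq_two_or_odd with h2 | h2
      · subst h2
        have : 0 ≤ Real.log 2 := by positivity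
        simp only [logWeight, chiFour_eq, vonMangoldt_apply_prime Nat.prime_two, Nat.prime_two,
          if_true]
        norm_num
        linarith
      · have h2n : n ≠ 2 := by rintro rfl; omega
        rw [vonMangoldt_apply_prime hp, chiFour_eq, logWeight]
        rcases (by omega : n % 4 = 1 ∨ n % 4 = 3) with h4 | h4
        · simp [h4, hp, h2n]
        · simp [h4, hp, h2n]; apply le_of_eq; ring
    · have h2n : n ≠ 2 := by rintro rfl; exact hp Nat.prime_two
      simp only [hp, if_false, h2n, logWeight, false_and]
      nlinarith
  have h := sum_le_sum hle
  rw [sum_sub_distrib, sum_add_distrib, sum_add_distrib, ← mul_sum] at h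
  have h1 := (abs_le.1 (hC N)).2
  have h2 := le_sum_vonMangoldt_div hN
  have h3 : ∑ n ∈ Ioc 0 N, (if n.Prime then 0 else Λ n) / (n : ℝ) ≤ K :=
    hs.sum_le_tsum _ fun n _ => by
      split_ifs
      · simp
      · exact div_nonneg vonMangoldt_nonneg (by positivity)
  have h4 : ∑ n ∈ Ioc 0 N, (if n = 2 then Real.log 2 else 0) ≤ Real.log 2 := by
    rw [sum_ite_eq']
    split_ifs
    · exact le_rfl
    · positivity
  linarith

/-- `2 / p` for primes `p ≡ 3 mod 4`, and `0` elsewhere. -/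
noncomputable def recipWeight (n : ℕ) : ℝ :=
  if n.Prime ∧ n % 4 = 3 then 2 / n else 0

lemma recipWeight_nonneg (n : ℕ) : 0 ≤ recipWeight n := by
  unfold recipWeight; split_ifs <;> positivity

lemma logWeight_eq (n : ℕ) : logWeight n = Real.log n * recipWeight n := by
  unfold logWeight recipWeight; split_ifs <;> ring

/-- Mertens' second theorem for primes `≡ 3 mod 4`, upper bound. -/
lemma sum_recipWeight_le : ∃ C : ℝ, ∀ N : ℕ, 2 ≤ N →
    ∑ n ∈ Ioc 0 N, recipWeight n ≤ Real.log (Real.log N) + C := by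
  obtain ⟨C, hC⟩ := sum_logWeight_le
  have hl2 : 0 < Real.log 2 := Real.log_pos (by norm_num)
  refine ⟨1 - Real.log (Real.log 2) + C / Real.log 2, fun N hN => ?_⟩
  have logpos : ∀ N : ℕ, 2 ≤ N → 0 < Real.log N := fun N hN =>
    Real.log_pos (by exact_mod_cast hN)
  -- Partial summation as an induction: the left side grows by `B * (1 / u - 1 / v)` with `B ≤ u +
  -- C`, and `1 - u / v ≤ log v - log u` telescopes to `log log N`.
  have key : ∑ n ∈ Ioc 0 N, recipWeight n - (∑ n ∈ Ioc 0 N, logWeight n) / Real.log N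
      ≤ Real.log (Real.log N) - Real.log (Real.log 2) + C * (1 / Real.log 2 - 1 / Real.log N) := by
    induction N, hN using Nat.le_induction with
    | base => simp [sum_Ioc_succ_top, recipWeight, logWeight]
    | succ N hN ih =>
      have hp := logpos N hN
      have hp1 := logpos (N + 1) (by omega)
      have hle : Real.log N ≤ Real.log (N + 1 : ℕ) :=
        Real.log_le_log (by exact_mod_cast (by omega : 0 < N)) (by exact_mod_cast Nat.le_succ N)
      rw [sum_Ioc_succ_top (Nat.zero_le N), sum_Ioc_succ_top (Nat.zero_le N), logWeight_eq (N + 1)]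
      have hB := hC N (by omega)
      set B := ∑ n ∈ Ioc 0 N, logWeight n
      set Q := ∑ n ∈ Ioc 0 N, recipWeight n
      set u := Real.log N
      set v := Real.log (N + 1 : ℕ)
      have e : Q + recipWeight (N + 1) - (B + v * recipWeight (N + 1)) / v
          = (Q - B / u) + B * (1 / u - 1 / v) := by field_simp; ring
      rw [e]
      have hd : 0 ≤ 1 / u - 1 / v := sub_nonneg.2 (one_div_le_one_div_of_le hp hle)
      have h1 : B * (1 / u - 1 / v) ≤ (u + C) * (1 / u - 1 / v) := by gcongr
      have h2 : u * (1 / u - 1 / v) ≤ Real.log v - Real.log u := by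
        have := Real.log_le_sub_one_of_pos (div_pos hp hp1)
        rw [Real.log_div hp.ne' hp1.ne'] at this
        have e2 : u * (1 / u - 1 / v) = 1 - u / v := by field_simp
        linarith
      nlinarith
  have hp := logpos N hN
  have h1 : (∑ n ∈ Ioc 0 N, logWeight n) / Real.log N ≤ 1 + C * (1 / Real.log N) := by
    rw [div_le_iff₀ hp]
    have := hC N (by omega)
    have e : (1 + C * (1 / Real.log N)) * Real.log N = Real.log N + C := by field_simp
    linarith
  have e : C * (1 / Real.log 2 - 1 / Real.log N) = C / Real.log 2 - C * (1 / Real.log N) := by ring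
  linarith

/-- If the tail beyond `P` were at most `1 / 2`, the log-weighted sum would be at most `(log N) / 2
+ O(1)`, against the Mertens lower bound `log N - C`. -/
lemma not_summable_recipWeight : ¬ Summable recipWeight := by
  intro hs
  obtain ⟨C, hC⟩ := le_sum_logWeight
  obtain ⟨P, hP⟩ : ∃ P : ℕ, ∀ N, P ≤ N → ∑ n ∈ Ioc P N, recipWeight n ≤ 1 / 2 := by
    have ht := hs.hasSum.tendsto_sum_nat
    have he := ht.eventually (lt_mem_nhds
      (show (∑' n, recipWeight n) - 1 / 2 < ∑' n, recipWeight n by linarith))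
    obtain ⟨P, hP⟩ := he.exists
    refine ⟨P, fun N hN => ?_⟩
    have h1 := hs.sum_le_tsum (Finset.range (P) ∪ Ioc P N) fun n _ => recipWeight_nonneg n
    rw [sum_union (by
      rw [disjoint_left]; intro x hx hx'
      simp only [mem_range, mem_Ioc] at hx hx'; omega)] at h1
    linarith
  have htend : Filter.Tendsto (fun N : ℕ => Real.log N) Filter.atTop Filter.atTop :=
    Real.tendsto_log_atTop.comp tendsto_natCast_atTop_atTop
  obtain ⟨N, hN1, hN2⟩ := ((htend.eventually_gt_atTop
    (2 * (C + ∑ n ∈ Ioc 0 P, logWeight n))).and (Filter.eventually_ge_atTop (P + 1))).exists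
  have h1 := hC N (by omega)
  rw [← sum_Ioc_consecutive _ (Nat.zero_le P) (by omega : P ≤ N)] at h1
  have h2 : ∑ n ∈ Ioc P N, logWeight n ≤ Real.log N * ∑ n ∈ Ioc P N, recipWeight n := by
    rw [mul_sum]
    refine sum_le_sum fun n hn => ?_
    rw [mem_Ioc] at hn
    rw [logWeight_eq]
    have := recipWeight_nonneg n
    gcongr
    · exact_mod_cast (by omega : 0 < n)
    · exact hn.2
  have h3 := hP N (by omega)
  have h4 : 0 ≤ Real.log N := by positivity
  nlinarith

/-- Finite sets of primes `p ≡ 3 mod 4` beyond any bound have arbitrarily large reciprocal sums. -/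
lemma exists_finset_primes_sum_inv_ge (P : ℕ) (M : ℝ) : ∃ T : Finset ℕ,
    (∀ p ∈ T, p.Prime ∧ p % 4 = 3 ∧ P < p) ∧ M ≤ ∑ p ∈ T, 1 / (p : ℝ) := by
  have ht := (not_summable_iff_tendsto_nat_atTop_of_nonneg recipWeight_nonneg).1
    not_summable_recipWeight
  obtain ⟨N, hN⟩ := (ht.eventually_ge_atTop
    (2 * M + ∑ n ∈ Finset.range (P + 1), recipWeight n)).exists
  refine ⟨(Finset.range N \ Finset.range (P + 1)).filter fun p => p.Prime ∧ p % 4 = 3, ?_, ?_⟩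
  · intro p hp
    simp only [mem_filter, mem_sdiff, mem_range, not_lt] at hp
    exact ⟨hp.2.1, hp.2.2, by omega⟩
  · have h1 : ∑ n ∈ Finset.range N, recipWeight n
        ≤ ∑ n ∈ Finset.range N \ Finset.range (P + 1), recipWeight n
          + ∑ n ∈ Finset.range (P + 1), recipWeight n := by
      rw [← sum_union sdiff_disjoint, sdiff_union_self_eq_union]
      exact sum_le_sum_of_subset_of_nonneg subset_union_left fun n _ _ => recipWeight_nonneg n
    have h2 : ∑ n ∈ Finset.range N \ Finset.range (P + 1), recipWeight n
        = 2 * ∑ p ∈ (Finset.range N \ Finset.range (P + 1)).filter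
            (fun p => p.Prime ∧ p % 4 = 3), 1 / (p : ℝ) := by
      rw [mul_sum, sum_filter]
      refine sum_congr rfl fun n _ => ?_
      unfold recipWeight; split_ifs <;> ring
    linarith

end PrimeSums

/-! ### Counting coordinate sums: multiplicativity, the primes 1 modulo 4, and the primes 2 and 3.
-/

section HypSums

/-- The coordinate sums `x + y` of the solutions of `x * y = a` in a commutative ring. -/
def hypSums {R : Type*} [CommRing R] (a : R) : Set R := {t | ∃ x y : R, x * y = a ∧ x + y = t}

/-- The number of coordinate sums modulo `n` of the solutions of `x * y = a`. -/
noncomputable def hypCount (n : ℕ) (a : ℤ) : ℕ := (hypSums (a : ZMod n)).ncard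

lemma hypSums_nonempty {R : Type*} [CommRing R] (a : R) : (hypSums a).Nonempty :=
  ⟨1 + a, 1, a, one_mul a, rfl⟩

lemma hypCount_pos {n : ℕ} (hn : n ≠ 0) (a : ℤ) : 0 < hypCount n a := by
  have : NeZero n := ⟨hn⟩
  exact (Set.ncard_pos (Set.toFinite _)).2 (hypSums_nonempty _)

lemma hypCount_le {n : ℕ} (hn : n ≠ 0) (a : ℤ) : hypCount n a ≤ n := by
  have : NeZero n := ⟨hn⟩
  calc hypCount n a ≤ (Set.univ : Set (ZMod n)).ncard :=
        Set.ncard_le_ncard (Set.subset_univ _) (Set.toFinite _)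
    _ = n := by rw [Set.ncard_univ, Nat.card_zmod]

lemma isUnit_intCast_zmod {a : ℤ} {n : ℕ} (h : IsCoprime a (n : ℤ)) : IsUnit (a : ZMod n) := by
  obtain ⟨u, v, huv⟩ := h
  refine IsUnit.of_mul_eq_one (u : ZMod n) ?_
  have := congrArg (fun z : ℤ => (z : ZMod n)) huv
  push_cast at this
  rw [ZMod.natCast_self, mul_zero, add_zero] at this
  rw [mul_comm]; exact this

/-- Representatives in `[1, n)` of a solution of `x * y = a` modulo `n`. -/
lemma exists_mem_modHyperbola {a : ℤ} {n : ℕ} (hn : 2 ≤ n) (h : IsCoprime a (n : ℤ))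
    {x y : ZMod n} (hxy : x * y = a) :
    ∃ p ∈ modHyperbola a n, ((p.1 : ℤ) : ZMod n) = x ∧ ((p.2 : ℤ) : ZMod n) = y := by
  have : NeZero n := ⟨by omega⟩
  have : Fact (1 < n) := ⟨by omega⟩
  have hu : IsUnit (x * y) := hxy ▸ isUnit_intCast_zmod h
  have hx : x ≠ 0 := (isUnit_of_mul_isUnit_left hu).ne_zero
  have hy : y ≠ 0 := (isUnit_of_mul_isUnit_right hu).ne_zero
  refine ⟨((x.val : ℤ), (y.val : ℤ)), ?_, by simp, by simp⟩
  have hx1 : 0 < x.val := ZMod.val_pos.2 hx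
  have hy1 : 0 < y.val := ZMod.val_pos.2 hy
  have hx2 := ZMod.val_lt x
  have hy2 := ZMod.val_lt y
  simp only [modHyperbola, Finset.mem_filter, Finset.mem_product, Finset.mem_Ico]
  refine ⟨⟨⟨by omega, by omega⟩, by omega, by omega⟩, ?_⟩
  rw [← ZMod.intCast_eq_intCast_iff]
  simpa using hxy

lemma intCast_mul_of_mem_modHyperbola {a : ℤ} {n : ℕ} {p : ℤ × ℤ} (hp : p ∈ modHyperbola a n) :
    ((p.1 : ℤ) : ZMod n) * ((p.2 : ℤ) : ZMod n) = a := by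
  have := (Finset.mem_filter.1 hp).2
  rw [← ZMod.intCast_eq_intCast_iff] at this
  simpa using this

lemma card_redSumset {a : ℤ} {n : ℕ} (hn : 2 ≤ n) (h : IsCoprime a (n : ℤ)) :
    (redSumset a n).card = hypCount n a := by
  rw [hypCount, ← Set.ncard_coe_finset]
  congr 1
  ext t
  simp only [redSumset, Finset.coe_image, Set.mem_image, Finset.mem_coe, hypSums, Set.mem_ofPred_eq]
  constructor
  · rintro ⟨p, hp, rfl⟩
    exact ⟨_, _, intCast_mul_of_mem_modHyperbola hp, by push_cast; rfl⟩
  · rintro ⟨x, y, hxy, rfl⟩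
    obtain ⟨p, hp, rfl, rfl⟩ := exists_mem_modHyperbola hn h hxy
    exact ⟨p, hp, by push_cast; rfl⟩

lemma card_redDiffset {a : ℤ} {n : ℕ} (hn : 2 ≤ n) (h : IsCoprime a (n : ℤ)) :
    (redDiffset a n).card = hypCount n (-a) := by
  rw [hypCount, ← Set.ncard_coe_finset]
  congr 1
  ext t
  simp only [redDiffset, Finset.coe_image, Set.mem_image, Finset.mem_coe, hypSums,
    Set.mem_ofPred_eq]
  constructor
  · rintro ⟨p, hp, rfl⟩
    refine ⟨p.1, -p.2, ?_, by push_cast; ring⟩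
    rw [mul_neg, intCast_mul_of_mem_modHyperbola hp]; push_cast; rfl
  · rintro ⟨x, y, hxy, rfl⟩
    obtain ⟨p, hp, h1, h2⟩ := exists_mem_modHyperbola hn h (x := x) (y := -y)
      (by rw [mul_neg, hxy]; push_cast; ring)
    exact ⟨p, hp, by push_cast; rw [h1, h2]; ring⟩

lemma redRatio_eq {a : ℤ} {n : ℕ} (hn : 2 ≤ n) (h : IsCoprime a (n : ℤ)) :
    redRatio a n = (hypCount n a : ℝ) / hypCount n (-a) := by
  rw [redRatio, card_redSumset hn h, card_redDiffset hn h]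

/-- Multiplicativity of `hypCount` in the modulus. -/
lemma hypCount_mul {m n : ℕ} (h : m.Coprime n) (a : ℤ) :
    hypCount (m * n) a = hypCount m a * hypCount n a := by
  have e : (ZMod.chineseRemainder h) '' hypSums (a : ZMod (m * n))
      = hypSums (a : ZMod m) ×ˢ hypSums (a : ZMod n) := by
    ext ⟨t, s⟩
    simp only [Set.mem_image, Set.mem_prod, hypSums, Set.mem_ofPred_eq]
    constructor
    · rintro ⟨_, ⟨x, y, hxy, rfl⟩, hts⟩
      have h1 : ZMod.chineseRemainder h x * ZMod.chineseRemainder h y = (a : ZMod m × ZMod n) := by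
        rw [← map_mul, hxy, map_intCast]
      rw [map_add] at hts
      exact ⟨⟨_, _, congrArg Prod.fst h1, congrArg Prod.fst hts⟩,
        _, _, congrArg Prod.snd h1, congrArg Prod.snd hts⟩
    · rintro ⟨⟨x, y, hxy, rfl⟩, x', y', hxy', rfl⟩
      refine ⟨_, ⟨(ZMod.chineseRemainder h).symm (x, x'), (ZMod.chineseRemainder h).symm (y, y'),
        ?_, rfl⟩, ?_⟩
      · rw [← map_mul, Prod.mk_mul_mk, hxy, hxy']
        exact (map_intCast (ZMod.chineseRemainder h).symm a)
      · rw [← map_add, RingEquiv.apply_symm_apply]; rfl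
  rw [hypCount, ← Set.ncard_image_of_injective _ (ZMod.chineseRemainder h).injective, e,
    Set.ncard_prod]
  rfl

/-- If `-1` is a square then `hypSums a` and `hypSums (-a)` correspond. -/
lemma ncard_hypSums_le_of_sq_eq_neg_one {R : Type*} [CommRing R] [Finite R] {i : R}
    (hi : i * i = -1) (a : R) : (hypSums a).ncard ≤ (hypSums (-a)).ncard := by
  refine Set.ncard_le_ncard_of_injOn (fun t => i * t) ?_ ?_ (Set.toFinite _)
  · rintro _ ⟨x, y, rfl, rfl⟩
    exact ⟨i * x, i * y, by linear_combination (x * y) * hi, by ring⟩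
  · intro s _ t _ hst
    simp only at hst
    linear_combination (-i) * hst + (s - t) * hi

/-- Raising to the power `p ^ k` improves a congruence modulo `p` to one modulo `p ^ (k + 1)`. Since
`p ^ k` is odd, `z ^ 2 ≡ -1 mod p` gives `(z ^ (p ^ k)) ^ 2 ≡ -1`. -/
lemma exists_sq_eq_neg_one_zmod_prime_pow {p : ℕ} (hp : p.Prime) (h : p % 4 = 1) (k : ℕ) :
    ∃ i : ZMod (p ^ k), i * i = -1 := by
  have := Fact.mk hp
  obtain ⟨r, hr⟩ := ZMod.exists_sq_eq_neg_one_iff.2 (by omega : p % 4 ≠ 3)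
  obtain ⟨z, rfl⟩ := ZMod.intCast_surjective r
  have h1 : (p : ℤ) ∣ z * z - (-1) := by
    rw [← ZMod.intCast_zmod_eq_zero_iff_dvd]
    push_cast
    rw [← hr]; ring
  have h2 := dvd_sub_pow_of_dvd_sub h1 k
  have hodd : Odd (p ^ k) := (Nat.odd_iff.2 (by omega)).pow
  rw [hodd.neg_one_pow] at h2
  have h3 : ((p ^ k : ℕ) : ℤ) ∣ ((z * z) ^ p ^ k - (-1) : ℤ) :=
    dvd_trans (by push_cast; exact pow_dvd_pow _ (Nat.le_succ k)) h2
  refine ⟨(z : ZMod (p ^ k)) ^ p ^ k, ?_⟩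
  have := (ZMod.intCast_zmod_eq_zero_iff_dvd _ _).2 h3
  push_cast at this
  rw [← mul_pow]
  linear_combination this

lemma hypCount_le_of_mod_four_eq_one {p : ℕ} (hp : p.Prime) (h : p % 4 = 1) (k : ℕ) (a : ℤ) :
    hypCount (p ^ k) a ≤ hypCount (p ^ k) (-a) := by
  have : NeZero (p ^ k) := ⟨pow_ne_zero _ hp.ne_zero⟩
  obtain ⟨i, hi⟩ := exists_sq_eq_neg_one_zmod_prime_pow hp h k
  have := ncard_hypSums_le_of_sq_eq_neg_one hi (a : ZMod (p ^ k))
  simpa [hypCount] using this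

/-- A residue class on which `x + a / x` is injective up to a bounded power of `p` gives a lower
bound of the right order for `hypCount`. -/
lemma pow_le_mul_hypCount {p j : ℕ} (hp : p.Prime) {a x₀ : ℤ} (hx : IsCoprime x₀ (p : ℤ))
    (hj : ¬ (p : ℤ) ^ (j + 1) ∣ x₀ * x₀ - a) (k : ℕ) :
    p ^ k ≤ p ^ (2 * j + 1) * hypCount (p ^ k) a := by
  have hpk : p ^ k ≠ 0 := pow_ne_zero _ hp.ne_zero
  rcases le_or_gt k (2 * j + 1) with hk | hk
  · exact (Nat.pow_le_pow_right hp.pos hk).trans (Nat.le_mul_of_pos_right _ (hypCount_pos hpk a))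
  obtain ⟨l, rfl⟩ := Nat.exists_eq_add_of_le hk.le
  suffices hle : p ^ l ≤ hypCount (p ^ (2 * j + 1 + l)) a by
    calc p ^ (2 * j + 1 + l) = p ^ (2 * j + 1) * p ^ l := pow_add _ _ _
      _ ≤ _ := Nat.mul_le_mul_left _ hle
  have : NeZero (p ^ (2 * j + 1 + l)) := ⟨hpk⟩
  set n := p ^ (2 * j + 1 + l)
  set X : ℕ → ℤ := fun u => x₀ + (p : ℤ) ^ (j + 1) * u with hX
  have hunit : ∀ u, ((X u : ℤ) : ZMod n) * ((X u : ℤ) : ZMod n)⁻¹ = 1 := by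
    intro u
    refine ZMod.mul_inv_of_unit _ (isUnit_intCast_zmod ?_)
    push_cast [n]
    refine IsCoprime.pow_right ?_
    have := hx.add_mul_left_left ((p : ℤ) ^ j * u)
    simpa [X, pow_succ, mul_comm, mul_assoc, mul_left_comm] using this
  have hcard : ((Finset.range (p ^ l) : Finset ℕ) : Set ℕ).ncard = p ^ l := by
    rw [Set.ncard_coe_finset, Finset.card_range]
  refine hcard.ge.trans ?_
  refine Set.ncard_le_ncard_of_injOn
    (fun u => ((X u : ℤ) : ZMod n) + (a : ZMod n) * ((X u : ℤ) : ZMod n)⁻¹) ?_ ?_ (Set.toFinite _)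
  · intro u _
    exact ⟨(X u : ZMod n), (a : ZMod n) * (X u : ZMod n)⁻¹,
      by linear_combination (a : ZMod n) * hunit u, rfl⟩
  · intro u hu v hv huv
    simp only at huv
    simp only [Finset.coe_range, Set.mem_Iio] at hu hv
    -- Clearing denominators in an equality of sums factors it. The second factor is congruent to
    -- `x₀ * x₀ - a` modulo `p ^ (j + 1)`, so it absorbs at most `p ^ j`; the first is `p ^ (j + 1)
    -- * (u - v)`, which leaves `p ^ l ∣ u - v`.
    have h0 : (((X u - X v) * (X u * X v - a) : ℤ) : ZMod n) = 0 := by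
      push_cast
      linear_combination (X u : ZMod n) * (X v : ZMod n) * huv
        - (a : ZMod n) * (X v : ZMod n) * hunit u + (a : ZMod n) * (X u : ZMod n) * hunit v
    rw [ZMod.intCast_zmod_eq_zero_iff_dvd] at h0
    have hB : ¬ (p : ℤ) ^ (j + 1) ∣ X u * X v - a := by
      intro hd
      refine hj ?_
      have e : x₀ * x₀ - a = (X u * X v - a)
          - (p : ℤ) ^ (j + 1) * (x₀ * v + x₀ * u + (p : ℤ) ^ (j + 1) * u * v) := by
        simp only [hX]; ring
      rw [e]
      exact dvd_sub hd (dvd_mul_right _ _)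
    have hpZ : Prime (p : ℤ) := Nat.prime_iff_prime_int.1 hp
    have e : (n : ℤ) = (p : ℤ) ^ ((j + l) + j + 1) := by
      push_cast [n]; congr 1; ring
    have h1 : (p : ℤ) ^ (j + l + 1) ∣ X u - X v := by
      rw [e] at h0
      obtain ⟨i, hi, c, hc, hcB⟩ :
          ∃ i ≤ j, ∃ c, X u * X v - a = (p : ℤ) ^ i * c ∧ ¬ (p : ℤ) ∣ c := by
        have hne : X u * X v - a ≠ 0 := fun h => hB (h ▸ dvd_zero _)
        have hfin : FiniteMultiplicity (p : ℤ) (X u * X v - a) :=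
          FiniteMultiplicity.of_not_isUnit hpZ.not_isUnit hne
        obtain ⟨c, hc, hcB⟩ := hfin.exists_eq_pow_mul_and_not_dvd
        refine ⟨_, ?_, c, hc, hcB⟩
        by_contra hlt
        push Not at hlt
        exact hB (hc ▸ dvd_mul_of_dvd_left (pow_dvd_pow _ hlt) _)
      rw [hc] at h0
      have h2 : (p : ℤ) ^ (i + (j + l + 1)) ∣ (p : ℤ) ^ i * ((X u - X v) * c) := by
        refine dvd_trans (pow_dvd_pow _ (by omega)) (h0.trans (dvd_of_eq (by ring)))
      rw [pow_add] at h2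
      have h3 := (mul_dvd_mul_iff_left (pow_ne_zero i hpZ.ne_zero)).1 h2
      exact hpZ.pow_dvd_of_dvd_mul_right _ hcB h3
    have h2 : (p : ℤ) ^ (j + 1) * (p : ℤ) ^ l ∣ (p : ℤ) ^ (j + 1) * ((u : ℤ) - v) := by
      refine (dvd_of_eq (by ring)).trans (h1.trans (dvd_of_eq ?_))
      simp only [hX]; ring
    have h3 := (mul_dvd_mul_iff_left (pow_ne_zero (j + 1) hpZ.ne_zero)).1 h2
    have h4 : ((p ^ l : ℕ) : ℤ) ∣ (u : ℤ) - v := by push_cast; exact h3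
    have h5 := Int.eq_zero_of_abs_lt_dvd h4 (by rw [abs_lt]; constructor <;> omega)
    omega

/-- The numbers `1 - a` and `9 - a` differ by 8, so 16 does not divide both and one of `x₀ = 1, 3`
works with `j = 3`; then `128 = 2 ^ 7`. For the prime 3 below, `1 - a` and `4 - a` play this role
modulo 9. -/
lemma two_pow_le_mul_hypCount (a : ℤ) (k : ℕ) :
    2 ^ k ≤ 128 * hypCount (2 ^ k) a := by
  by_cases h : a % 16 = 1
  · exact pow_le_mul_hypCount (j := 3) Nat.prime_two (x₀ := 3) (by norm_num)
      (by norm_num; omega) k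
  · exact pow_le_mul_hypCount (j := 3) Nat.prime_two (x₀ := 1) (by norm_num)
      (by norm_num; omega) k

lemma three_pow_le_mul_hypCount (a : ℤ) (k : ℕ) : 3 ^ k ≤ 27 * hypCount (3 ^ k) a := by
  by_cases h : a % 9 = 1
  · exact pow_le_mul_hypCount (j := 1) Nat.prime_three (x₀ := 2) (by norm_num)
      (by norm_num; omega) k
  · exact pow_le_mul_hypCount (j := 1) Nat.prime_three (x₀ := 1) (by norm_num)
      (by norm_num; omega) k

end HypSums

/-! ### The map `x ↦ x + a / x` modulo a prime power, split by whether `x² ≡ a mod p`. -/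

section PrimePower

open Finset

variable {p k : ℕ}

/-- Reduction `ℤ/p^kℤ → ℤ/pℤ`, for `k ≠ 0`. -/
def primePowRed (p : ℕ) {k : ℕ} (hk : k ≠ 0) : ZMod (p ^ k) →+* ZMod p :=
  ZMod.castHom (dvd_pow_self p hk) (ZMod p)

lemma primePowRed_surjective (p : ℕ) {k : ℕ} (hk : k ≠ 0) :
    Function.Surjective (primePowRed p hk) :=
  ZMod.ringHom_surjective _

lemma isUnit_iff_primePowRed_ne_zero (hp : p.Prime) (hk : k ≠ 0) (x : ZMod (p ^ k)) :
    IsUnit x ↔ primePowRed p hk x ≠ 0 := by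
  have : NeZero (p ^ k) := ⟨pow_ne_zero _ hp.ne_zero⟩
  obtain ⟨m, rfl⟩ := ZMod.natCast_zmod_surjective x
  rw [ZMod.isUnit_iff_coprime, map_natCast, Ne, ZMod.natCast_eq_zero_iff,
    Nat.coprime_pow_right_iff (Nat.pos_of_ne_zero hk), Nat.coprime_comm, hp.coprime_iff_not_dvd]

/-- All fibres of a surjective homomorphism have the same size; taking the condition `True` shows
that this size is `p ^ (k - 1)`. -/
lemma card_filter_primePowRed (hp : p.Prime) (hk : k ≠ 0) [NeZero (p ^ k)] [NeZero p]
    (P : ZMod p → Prop) [DecidablePred P] :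
    #{x : ZMod (p ^ k) | P (primePowRed p hk x)} = p ^ (k - 1) * #{r : ZMod p | P r} := by
  have hfib : ∀ r : ZMod p, #{x : ZMod (p ^ k) | primePowRed p hk x = r}
      = #{x : ZMod (p ^ k) | primePowRed p hk x = 0} := fun r =>
    AddMonoidHom.card_fiber_eq_of_mem_range (primePowRed p hk).toAddMonoidHom
      (primePowRed_surjective p hk r) (primePowRed_surjective p hk 0)
  have hsum : ∀ Q : ZMod p → Prop, ∀ _ : DecidablePred Q,
      #{x : ZMod (p ^ k) | Q (primePowRed p hk x)}
        = #{x : ZMod (p ^ k) | primePowRed p hk x = 0} * #{r : ZMod p | Q r} := by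
    intro Q _
    rw [card_eq_sum_card_fiberwise (f := primePowRed p hk) (t := {r : ZMod p | Q r})
      (fun x hx => by simpa using hx), mul_comm, ← smul_eq_mul, ← sum_const]
    refine sum_congr rfl fun r hr => ?_
    rw [← hfib r, filter_filter]
    congr 1
    ext x
    simp only [mem_filter, mem_univ, true_and] at hr ⊢
    exact ⟨fun h => h.2, fun h => ⟨h ▸ hr, h⟩⟩
  rw [hsum P inferInstance]
  congr 1
  have h1 := hsum (fun _ => True) inferInstance
  simp only [filter_true, card_univ, ZMod.card] at h1
  have h2 : p ^ k = p ^ (k - 1) * p := by rw [← pow_succ]; congr 1; omega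
  exact Nat.eq_of_mul_eq_mul_right hp.pos (h1.symm.trans h2)

/-- The number of square roots of `a` modulo `p`. -/
def rootCount (p : ℕ) [NeZero p] (a : ZMod p) : ℕ := #{r : ZMod p | r ^ 2 = a}

/-- The number of nonzero residues modulo `p` that are not square roots of `a`. -/
def nonrootCount (p : ℕ) [NeZero p] (a : ZMod p) : ℕ := #{r : ZMod p | r ≠ 0 ∧ r ^ 2 ≠ a}

lemma nonrootCount_add_rootCount [Fact p.Prime] {a : ZMod p} (ha : a ≠ 0) :
    nonrootCount p a + rootCount p a + 1 = p := by
  have h0 : #{r : ZMod p | r = 0} = 1 := by simp [filter_eq']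
  have hd1 : Disjoint (univ.filter fun r : ZMod p => r ≠ 0 ∧ r ^ 2 ≠ a)
      (univ.filter fun r : ZMod p => r ^ 2 = a) := by
    rw [disjoint_filter]; intro r _ h1 h2; exact h1.2 h2
  have hd2 : Disjoint ((univ.filter fun r : ZMod p => r ≠ 0 ∧ r ^ 2 ≠ a) ∪
      (univ.filter fun r : ZMod p => r ^ 2 = a)) (univ.filter fun r : ZMod p => r = 0) := by
    rw [← filter_or, disjoint_filter]
    rintro r _ (h1 | h1) h2
    · exact h1.1 h2
    · rw [h2] at h1; exact ha (by rw [← h1]; ring)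
  rw [rootCount, nonrootCount, ← h0, ← card_union_of_disjoint hd1, ← card_union_of_disjoint hd2]
  have : ((univ.filter fun r : ZMod p => r ≠ 0 ∧ r ^ 2 ≠ a) ∪
      (univ.filter fun r : ZMod p => r ^ 2 = a)) ∪ (univ.filter fun r : ZMod p => r = 0)
      = univ := by
    ext r; simp; tauto
  rw [this, card_univ, ZMod.card]

lemma rootCount_eq [Fact p.Prime] (h2 : p ≠ 2) (a : ZMod p) :
    (rootCount p a : ℤ) = quadraticChar (ZMod p) a + 1 := by
  rw [← quadraticChar_card_sqrts (by rwa [ZMod.ringChar_zmod_n]) a, rootCount]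
  congr 2
  ext r; simp

/-- For `p ≡ 3 mod 4` the element `-1` is a nonresidue, so exactly one of `a`, `-a` is a square.
This is the only source of imbalance between sums and differences at the large primes. -/
lemma rootCount_neg [Fact p.Prime] (h : p % 4 = 3) {a : ZMod p} (ha : a ≠ 0) :
    (rootCount p a = 0 ∧ rootCount p (-a) = 2) ∨ (rootCount p a = 2 ∧ rootCount p (-a) = 0) := by
  have h2 : p ≠ 2 := by rintro rfl; omega
  have e1 := rootCount_eq h2 a
  have e2 := rootCount_eq h2 (-a)
  rw [neg_eq_neg_one_mul a, map_mul, quadraticChar_neg_one (by rwa [ZMod.ringChar_zmod_n]),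
    ZMod.card, ZMod.χ₄_nat_three_mod_four h, ← neg_eq_neg_one_mul a] at e2
  rcases quadraticChar_dichotomy ha with h' | h' <;> rw [h'] at e1 e2 <;> omega

/-- The sum `x + a / x`. -/
def hypSum {n : ℕ} (a x : ZMod n) : ZMod n := x + a * x⁻¹

lemma hypSum_eq_iff {n : ℕ} {a x y : ZMod n} (hx : IsUnit x) (hy : IsUnit y) :
    hypSum a x = hypSum a y ↔ (x - y) * (x * y - a) = 0 := by
  have h1 := ZMod.mul_inv_of_unit x hx
  have h2 := ZMod.mul_inv_of_unit y hy
  rw [← sub_eq_zero, ← (hx.mul hy).mul_right_eq_zero, hypSum, hypSum]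
  have e : x * y * (x + a * x⁻¹ - (y + a * y⁻¹)) = (x - y) * (x * y - a) := by
    linear_combination a * y * h1 - a * x * h2
  rw [e]

lemma hypSums_eq_image {n : ℕ} {a : ZMod n} (ha : IsUnit a) :
    hypSums a = hypSum a '' {x | IsUnit x} := by
  ext t
  simp only [hypSums, Set.mem_image, Set.mem_ofPred_eq]
  constructor
  · rintro ⟨x, y, hxy, rfl⟩
    have hx : IsUnit x := isUnit_of_mul_isUnit_left (hxy ▸ ha)
    refine ⟨x, hx, ?_⟩
    rw [hypSum, ← hxy]
    linear_combination y * ZMod.mul_inv_of_unit x hx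
  · rintro ⟨x, hx, rfl⟩
    exact ⟨x, a * x⁻¹, by linear_combination a * ZMod.mul_inv_of_unit x hx, rfl⟩

variable (hk : k ≠ 0) [Fact p.Prime] [NeZero (p ^ k)]

/-- Units of `ℤ/p^kℤ` whose square is not congruent to `a` modulo `p`. -/
def regularPart (p : ℕ) {k : ℕ} (hk : k ≠ 0) [Fact p.Prime] [NeZero (p ^ k)] (a : ZMod (p ^ k)) :
    Finset (ZMod (p ^ k)) :=
  {x | primePowRed p hk x ≠ 0 ∧ primePowRed p hk x ^ 2 ≠ primePowRed p hk a}

/-- Elements of `ℤ/p^kℤ` whose square is congruent to `a` modulo `p`. -/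
def singularPart (p : ℕ) {k : ℕ} (hk : k ≠ 0) [Fact p.Prime] [NeZero (p ^ k)] (a : ZMod (p ^ k)) :
    Finset (ZMod (p ^ k)) :=
  {x | primePowRed p hk x ^ 2 = primePowRed p hk a}

lemma card_regularPart (a : ZMod (p ^ k)) :
    #(regularPart p hk a) = p ^ (k - 1) * nonrootCount p (primePowRed p hk a) :=
  card_filter_primePowRed Fact.out hk fun r => r ≠ 0 ∧ r ^ 2 ≠ primePowRed p hk a

lemma card_singularPart (a : ZMod (p ^ k)) :
    #(singularPart p hk a) = p ^ (k - 1) * rootCount p (primePowRed p hk a) :=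
  card_filter_primePowRed Fact.out hk fun r => r ^ 2 = primePowRed p hk a

variable {a : ZMod (p ^ k)}

lemma isUnit_of_mem_regularPart {x : ZMod (p ^ k)} (hx : x ∈ regularPart p hk a) : IsUnit x :=
  (isUnit_iff_primePowRed_ne_zero Fact.out hk x).2 (mem_filter.1 hx).2.1

lemma isUnit_of_mem_singularPart (ha : IsUnit a) {x : ZMod (p ^ k)}
    (hx : x ∈ singularPart p hk a) : IsUnit x := by
  rw [isUnit_iff_primePowRed_ne_zero Fact.out hk] at ha ⊢
  intro h
  have := (mem_filter.1 hx).2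
  rw [h] at this
  exact ha (by rw [← this]; ring)

lemma hypSums_eq_coe (ha : IsUnit a) : hypSums a =
    ((regularPart p hk a).image (hypSum a) ∪ (singularPart p hk a).image (hypSum a) :
      Finset (ZMod (p ^ k))) := by
  rw [hypSums_eq_image ha, ← image_union, coe_image]
  congr 1
  ext x
  simp only [Set.mem_ofPred_eq, coe_union, Set.mem_union, mem_coe]
  constructor
  · intro hx
    have := (isUnit_iff_primePowRed_ne_zero Fact.out hk x).1 hx
    simp only [regularPart, singularPart, mem_filter, mem_univ, true_and]
    tauto
  · rintro (hx | hx)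
    · exact isUnit_of_mem_regularPart hk hx
    · exact isUnit_of_mem_singularPart hk ha hx

/-- On the regular part the only coincidences are `y = x` and `y = a / x`. -/
lemma eq_or_mul_eq_of_mem_regularPart {x y : ZMod (p ^ k)} (hx : x ∈ regularPart p hk a)
    (hy : IsUnit y) (h : hypSum a x = hypSum a y) : y = x ∨ x * y = a := by
  have h0 := (hypSum_eq_iff (isUnit_of_mem_regularPart hk hx) hy).1 h
  by_cases hxy : primePowRed p hk (x - y) = 0
  · left
    have hu : IsUnit (x * y - a) := by
      rw [isUnit_iff_primePowRed_ne_zero Fact.out hk, map_sub, map_mul]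
      rw [map_sub, sub_eq_zero] at hxy
      rw [← hxy, ← pow_two, sub_ne_zero]
      exact (mem_filter.1 hx).2.2
    rw [hu.mul_left_eq_zero, sub_eq_zero] at h0
    exact h0.symm
  · right
    rw [((isUnit_iff_primePowRed_ne_zero Fact.out hk _).2 hxy).mul_right_eq_zero] at h0
    exact sub_eq_zero.1 h0

/-- The fibres are the orbits `{x, a / x}` of an involution, which preserves the regular part and
has no fixed point there. -/
lemma two_mul_card_image_regularPart (ha : IsUnit a) :
    2 * #((regularPart p hk a).image (hypSum a)) = #(regularPart p hk a) := by
  rw [card_eq_sum_card_image (hypSum a) (regularPart p hk a), mul_comm, ← smul_eq_mul, ← sum_const]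
  refine sum_congr rfl fun b hb => ?_
  obtain ⟨x, hx, rfl⟩ := mem_image.1 hb
  have hxu := isUnit_of_mem_regularPart hk hx
  have hinv := ZMod.mul_inv_of_unit x hxu
  have hxy : x * (a * x⁻¹) = a := by linear_combination a * hinv
  have hne : x ≠ a * x⁻¹ := by
    intro h
    rw [← h] at hxy
    exact (mem_filter.1 hx).2.2 (by rw [← hxy, map_mul, pow_two])
  rw [← card_pair hne]
  congr 1
  ext y
  simp only [mem_insert, mem_singleton, mem_filter]
  have hyu : IsUnit (a * x⁻¹) := isUnit_of_mul_isUnit_right (hxy ▸ ha)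
  constructor
  · rintro (rfl | rfl)
    · exact ⟨hx, rfl⟩
    · refine ⟨?_, ?_⟩
      · have h1 := (isUnit_iff_primePowRed_ne_zero Fact.out hk _).1 hyu
        refine mem_filter.2 ⟨mem_univ _, h1, fun h2 => (mem_filter.1 hx).2.2 ?_⟩
        have h3 : primePowRed p hk x * primePowRed p hk (a * x⁻¹) = primePowRed p hk a := by
          rw [← map_mul, hxy]
        have h4 : primePowRed p hk x = primePowRed p hk (a * x⁻¹) :=
          mul_right_cancel₀ h1 (by rw [h3, ← h2, pow_two])
        rw [h4, h2]
      · rw [hypSum_eq_iff hyu hxu]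
        linear_combination (a * x⁻¹ - x) * hxy
  · rintro ⟨hy, h⟩
    rcases eq_or_mul_eq_of_mem_regularPart hk hx (isUnit_of_mem_regularPart hk hy) h.symm with h | h
    · exact Or.inl h
    · right
      rw [← h]; linear_combination (-y) * hinv

lemma nonrootCount_le_two_mul_ncard (ha : IsUnit a) :
    p ^ (k - 1) * nonrootCount p (primePowRed p hk a) ≤ 2 * (hypSums a).ncard := by
  rw [← card_regularPart, ← two_mul_card_image_regularPart hk ha, hypSums_eq_coe hk ha,
    Set.ncard_coe_finset]
  exact Nat.mul_le_mul_left _ (card_le_card subset_union_left)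

lemma two_mul_ncard_le (ha : IsUnit a) :
    2 * (hypSums a).ncard ≤ p ^ (k - 1) * nonrootCount p (primePowRed p hk a)
      + 2 * #((singularPart p hk a).image (hypSum a)) := by
  rw [← card_regularPart, ← two_mul_card_image_regularPart hk ha, hypSums_eq_coe hk ha,
    Set.ncard_coe_finset, ← mul_add]
  exact Nat.mul_le_mul_left _ (card_union_le _ _)

lemma two_mul_ncard_le_pow_mul (ha : IsUnit a) :
    2 * (hypSums a).ncard ≤ p ^ (k - 1) * (nonrootCount p (primePowRed p hk a)
      + 2 * rootCount p (primePowRed p hk a)) := by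
  have h1 := two_mul_ncard_le hk ha
  have h2 := card_image_le (f := hypSum a) (s := singularPart p hk a)
  rw [card_singularPart] at h2
  calc _ ≤ _ := h1
    _ ≤ _ := Nat.add_le_add_left (Nat.mul_le_mul_left 2 h2) _
    _ = _ := by ring

/-- Modulo `p` the count is exact. -/
lemma le_two_mul_ncard_of_eq_one (hk1 : k = 1) (ha : IsUnit a) :
    nonrootCount p (primePowRed p hk a) + 2 * rootCount p (primePowRed p hk a)
      ≤ 2 * (hypSums a).ncard := by
  -- For `k = 1` reduction is a bijection, so singular elements satisfy `x² = a` exactly; their sums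
  -- are then distinct and avoid the regular ones.
  have hinj : ∀ x y : ZMod (p ^ k), primePowRed p hk x = primePowRed p hk y → x = y := by
    have hb : Function.Bijective (primePowRed p hk) := by
      rw [Fintype.bijective_iff_surjective_and_card]
      exact ⟨primePowRed_surjective p hk, by simp [ZMod.card, hk1]⟩
    exact fun x y h => hb.1 h
  have hdisj : Disjoint ((regularPart p hk a).image (hypSum a))
      ((singularPart p hk a).image (hypSum a)) := by
    rw [disjoint_left]
    intro t ht ht'
    obtain ⟨x, hx, rfl⟩ := mem_image.1 ht
    obtain ⟨y, hy, hxy⟩ := mem_image.1 ht'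
    have hyu := isUnit_of_mem_singularPart hk ha hy
    have hy2 := (mem_filter.1 hy).2
    rcases eq_or_mul_eq_of_mem_regularPart hk hx hyu hxy.symm with h | h
    · exact (mem_filter.1 hx).2.2 (h ▸ hy2)
    · have h1 : y * y = x * y := by
        rw [h]; exact hinj _ _ (by rw [map_mul, ← pow_two, hy2])
      exact (mem_filter.1 hx).2.2 (hyu.mul_left_injective h1 ▸ hy2)
  have hsing : #((singularPart p hk a).image (hypSum a)) = #(singularPart p hk a) := by
    refine card_image_of_injOn fun x hx y hy hxy => ?_
    have hxu := isUnit_of_mem_singularPart hk ha hx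
    have hyu := isUnit_of_mem_singularPart hk ha hy
    have h0 := (hypSum_eq_iff hxu hyu).1 hxy
    have hx2 := (mem_filter.1 hx).2
    have h1 : x * x = a := hinj _ _ (by rw [map_mul, ← pow_two, hx2])
    by_cases hd : x - y = 0
    · exact sub_eq_zero.1 hd
    · have hu : IsUnit (x - y) := by
        rw [isUnit_iff_primePowRed_ne_zero Fact.out hk]
        exact fun h => hd (hinj _ _ (by rw [h, map_zero]))
      rw [hu.mul_right_eq_zero, sub_eq_zero, ← h1] at h0
      exact (hxu.mul_right_injective h0).symm
  have h1 := card_regularPart hk a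
  have h2 := card_singularPart hk a
  rw [hypSums_eq_coe hk ha, Set.ncard_coe_finset, card_union_of_disjoint hdisj, mul_add,
    two_mul_card_image_regularPart hk ha, hsing, h1, h2]
  simp [hk1]

/-- Modulo `p ^ 2` the sums coming from the singular part collapse. -/
lemma two_mul_ncard_le_of_eq_two (hk2 : k = 2) (ha : IsUnit a) :
    2 * (hypSums a).ncard ≤ p * nonrootCount p (primePowRed p hk a)
      + 2 * rootCount p (primePowRed p hk a) := by
  have h1 := two_mul_ncard_le hk ha
  -- Two singular elements with the same residue make both `x - y` and `x * y - a` divisible by `p`,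
  -- so the product vanishes modulo `p ^ 2` and the sums coincide: one sum per square root.
  have hzero : ∀ x y : ZMod (p ^ k), primePowRed p hk x = 0 → primePowRed p hk y = 0 →
      x * y = 0 := by
    intro x y hx hy
    obtain ⟨m, rfl⟩ := ZMod.natCast_zmod_surjective x
    obtain ⟨n, rfl⟩ := ZMod.natCast_zmod_surjective y
    rw [map_natCast, ZMod.natCast_eq_zero_iff] at hx hy
    rw [← Nat.cast_mul, ZMod.natCast_eq_zero_iff, hk2, pow_two]
    exact mul_dvd_mul hx hy
  have h2 : #((singularPart p hk a).image (hypSum a)) ≤ rootCount p (primePowRed p hk a) := by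
    have hg : ∀ r : ZMod p, ∃ x : ZMod (p ^ k), primePowRed p hk x = r :=
      primePowRed_surjective p hk
    choose g hg using hg
    refine (card_le_card (t := (univ.filter fun r : ZMod p =>
      r ^ 2 = primePowRed p hk a).image fun r => hypSum a (g r)) ?_).trans card_image_le
    intro t ht
    obtain ⟨x, hx, rfl⟩ := mem_image.1 ht
    have hx2 := (mem_filter.1 hx).2
    refine mem_image.2 ⟨primePowRed p hk x, mem_filter.2 ⟨mem_univ _, hx2⟩, ?_⟩
    have hgm : g (primePowRed p hk x) ∈ singularPart p hk a :=
      mem_filter.2 ⟨mem_univ _, by rw [hg, hx2]⟩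
    rw [hypSum_eq_iff (isUnit_of_mem_singularPart hk ha hgm) (isUnit_of_mem_singularPart hk ha hx)]
    refine hzero _ _ ?_ ?_
    · rw [map_sub, hg, sub_self]
    · rw [map_sub, map_mul, hg, ← pow_two, hx2, sub_self]
  have h3 : p ^ (k - 1) = p := by simp [hk2]
  rw [h3] at h1
  omega

end PrimePower

/-! ### Upper and lower bounds for the local ratios, and large ratios from their products. -/

section LocalBounds

/-- Exponent of the local bound for `hypCount (p ^ k) a / hypCount (p ^ k) (-a)`. -/
noncomputable def localWeight (p : ℕ) : ℝ :=
  (if p ≤ 3 then 5 else 0) + recipWeight p + 12 / (p : ℝ) ^ 2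

lemma localWeight_nonneg (p : ℕ) : 0 ≤ localWeight p := by
  unfold localWeight
  have := recipWeight_nonneg p
  split_ifs <;> positivity

lemma primePowRed_intCast_ne_zero {p k : ℕ} [Fact p.Prime] (hk : k ≠ 0) {a : ℤ}
    (ha : IsCoprime a (p : ℤ)) : primePowRed p hk (a : ZMod (p ^ k)) ≠ 0 := by
  rw [map_intCast]
  exact (isUnit_intCast_zmod ha).ne_zero

lemma isUnit_intCast_zmod_pow {p k : ℕ} {a : ℤ} (ha : IsCoprime a (p : ℤ)) :
    IsUnit (a : ZMod (p ^ k)) :=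
  isUnit_intCast_zmod (by push_cast; exact ha.pow_right)

lemma exp_five_ge : (128 : ℝ) ≤ Real.exp 5 := by
  have h := Real.exp_one_gt_d9
  have e : Real.exp 5 = Real.exp 1 ^ 5 := by rw [← Real.exp_nat_mul]; norm_num
  rw [e]
  calc (128 : ℝ) ≤ 2.7 ^ 5 := by norm_num
    _ ≤ _ := by gcongr; linarith

/-- For 2 and 3 the trivial bound `p ^ k` is compared with at least `p ^ k / 128`, and `exp 5 ≥ 128`
explains the 5 in `localWeight`. For `p ≡ 3 mod 4`, `p ≥ 7`, every singular element is allowed its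
own sum above and none is counted below. -/
lemma hypCount_prime_pow_le {p k : ℕ} (hp : p.Prime) (hk : k ≠ 0) {a : ℤ}
    (ha : IsCoprime a (p : ℤ)) :
    (hypCount (p ^ k) a : ℝ) ≤ Real.exp (localWeight p) * hypCount (p ^ k) (-a) := by
  have hpk : p ^ k ≠ 0 := pow_ne_zero _ hp.ne_zero
  have hpos : (0 : ℝ) < hypCount (p ^ k) (-a) := by exact_mod_cast hypCount_pos hpk _
  have small : p ≤ 3 → p ^ k ≤ 128 * hypCount (p ^ k) (-a) →
      (hypCount (p ^ k) a : ℝ) ≤ Real.exp (localWeight p) * hypCount (p ^ k) (-a) := by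
    intro h3 h
    have h1 : (hypCount (p ^ k) a : ℝ) ≤ 128 * hypCount (p ^ k) (-a) := by
      exact_mod_cast (hypCount_le hpk a).trans h
    have h2 : (5 : ℝ) ≤ localWeight p := by
      unfold localWeight
      rw [if_pos h3]
      have := recipWeight_nonneg p
      have : (0 : ℝ) ≤ 12 / (p : ℝ) ^ 2 := by positivity
      linarith
    have h3 := exp_five_ge.trans (Real.exp_le_exp.2 h2)
    nlinarith
  have one_le : 1 ≤ Real.exp (localWeight p) := Real.one_le_exp (localWeight_nonneg p)
  rcases eq_or_ne p 2 with rfl | h2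
  · exact small (by norm_num) (two_pow_le_mul_hypCount (-a) k)
  rcases eq_or_ne p 3 with rfl | h3
  · exact small (by norm_num) ((three_pow_le_mul_hypCount (-a) k).trans
      (Nat.mul_le_mul_right _ (by norm_num)))
  have hodd := hp.eq_two_or_odd.resolve_left h2
  rcases (by omega : p % 4 = 1 ∨ p % 4 = 3) with h4 | h4
  · have : (hypCount (p ^ k) a : ℝ) ≤ hypCount (p ^ k) (-a) := by
      exact_mod_cast hypCount_le_of_mod_four_eq_one hp h4 k a
    nlinarith
  have hp7 : 7 ≤ p := by have := hp.two_le; omega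
  have := Fact.mk hp
  have : NeZero (p ^ k) := ⟨hpk⟩
  have hu := isUnit_intCast_zmod_pow (k := k) ha
  have hr := primePowRed_intCast_ne_zero hk ha
  have hU := two_mul_ncard_le_pow_mul hk hu
  have hL := nonrootCount_le_two_mul_ncard hk hu.neg
  rw [map_neg] at hL
  have e1 := nonrootCount_add_rootCount hr
  have e2 := nonrootCount_add_rootCount (neg_ne_zero.2 hr)
  have hs := rootCount_neg h4 hr
  rw [← Int.cast_neg] at hL
  change 2 * hypCount (p ^ k) a ≤ _ at hU
  change _ ≤ 2 * hypCount (p ^ k) (-a) at hL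
  set e := rootCount p (primePowRed p hk (a : ZMod (p ^ k)))
  set e' := rootCount p (-primePowRed p hk (a : ZMod (p ^ k)))
  set g := nonrootCount p (primePowRed p hk (a : ZMod (p ^ k)))
  set g' := nonrootCount p (-primePowRed p hk (a : ZMod (p ^ k)))
  -- Both `g + e` and `g' + e'` equal `p - 1`, and `e + e' = 2`.
  have h1 : g + 2 * e = g' + 2 := by omega
  have hg' : p ≤ g' + 3 := by omega
  have hp7' : (7 : ℝ) ≤ p := by exact_mod_cast hp7
  have hg'R : (p : ℝ) - 3 ≤ g' := by
    have : (p : ℝ) ≤ g' + 3 := by exact_mod_cast hg'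
    linarith
  have hg'0 : (0 : ℝ) < g' := by linarith
  rw [h1] at hU
  have hUR : 2 * (hypCount (p ^ k) a : ℝ) ≤ (p : ℝ) ^ (k - 1) * (g' + 2) := by exact_mod_cast hU
  have hLR : (p : ℝ) ^ (k - 1) * g' ≤ 2 * (hypCount (p ^ k) (-a) : ℝ) := by exact_mod_cast hL
  have h2 : (hypCount (p ^ k) a : ℝ) ≤ (1 + 2 / g') * hypCount (p ^ k) (-a) := by
    have e : (p : ℝ) ^ (k - 1) * (g' + 2) = (1 + 2 / g') * ((p : ℝ) ^ (k - 1) * g') := by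
      field_simp
    have : (1 + 2 / (g' : ℝ)) * ((p : ℝ) ^ (k - 1) * g')
        ≤ (1 + 2 / (g' : ℝ)) * (2 * hypCount (p ^ k) (-a)) := by gcongr
    linarith
  have h3 : 1 + 2 / (g' : ℝ) ≤ Real.exp (localWeight p) := by
    refine le_trans ?_ (Real.add_one_le_exp _)
    unfold localWeight recipWeight
    rw [if_neg (by omega), if_pos ⟨hp, h4⟩]
    have : 2 / (g' : ℝ) ≤ 2 / (p - 3) := by
      have : (0 : ℝ) < p - 3 := by linarith
      gcongr
    -- The difference `2 / (p - 3) - 2 / p = 6 / (p (p - 3))` is at most `12 / p ^ 2` as soon as `p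
    -- ≥ 6`.
    have : (2 : ℝ) / (p - 3) ≤ 2 / p + 12 / p ^ 2 := by
      have : (0 : ℝ) < p - 3 := by linarith
      rw [div_add_div _ _ (by positivity) (by positivity), div_le_div_iff₀ this (by positivity)]
      have hp0 : (0 : ℝ) < p := by linarith
      nlinarith [mul_pos (mul_pos hp0 hp0) hp0]
    linarith
  exact h2.trans (by gcongr)

lemma hypCount_le_exp_sum {a : ℤ} (n : ℕ) (hn : n ≠ 0) (ha : IsCoprime a (n : ℤ)) :
    (hypCount n a : ℝ) ≤ Real.exp (∑ p ∈ n.primeFactors, localWeight p) * hypCount n (-a) := by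
  induction n using Nat.recOnPosPrimePosCoprime with
  | zero => exact absurd rfl hn
  | one =>
    have h1 := hypCount_pos one_ne_zero (-a)
    have h2 := hypCount_le one_ne_zero a
    simpa using (by exact_mod_cast h2.trans h1 : (hypCount 1 a : ℝ) ≤ hypCount 1 (-a))
  | prime_pow p k hp hk =>
    rw [Nat.primeFactors_prime_pow hk.ne' hp, Finset.sum_singleton]
    refine hypCount_prime_pow_le hp hk.ne' ?_
    push_cast at ha
    exact (IsCoprime.pow_right_iff hk).1 ha
  | coprime m n hm hn' hmn ihm ihn =>
    push_cast at ha
    have h1 := ihm (by omega) ha.of_mul_right_left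
    have h2 := ihn (by omega) ha.of_mul_right_right
    rw [hypCount_mul hmn, hypCount_mul hmn, hmn.primeFactors_mul,
      Finset.sum_union hmn.disjoint_primeFactors, Real.exp_add]
    push_cast
    calc _ ≤ _ := mul_le_mul h1 h2 (by positivity) (by positivity)
      _ = _ := by ring

/-- Every large prime `p ≡ 3 mod 4` has a power at which sums noticeably outnumber differences. -/
lemma exists_prime_pow_le_hypCount {p : ℕ} (hp : p.Prime) (h4 : p % 4 = 3) (hp7 : 7 ≤ p) {a : ℤ}
    (ha : IsCoprime a (p : ℤ)) : ∃ k : ℕ, k ≠ 0 ∧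
      (1 + 1 / (p : ℝ)) * hypCount (p ^ k) (-a) ≤ hypCount (p ^ k) a := by
  have := Fact.mk hp
  have hp7' : (7 : ℝ) ≤ p := by exact_mod_cast hp7
  have hp0 : (0 : ℝ) < p := by linarith
  have main : ∀ k : ℕ, ∀ hk : k ≠ 0,
      let r := primePowRed p hk (a : ZMod (p ^ k))
      (rootCount p r = 0 ∧ rootCount p (-r) = 2 ∧ k = 2) ∨
        (rootCount p r = 2 ∧ rootCount p (-r) = 0 ∧ k = 1) →
      (1 + 1 / (p : ℝ)) * hypCount (p ^ k) (-a) ≤ hypCount (p ^ k) a := by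
    intro k hk r h
    have : NeZero (p ^ k) := ⟨pow_ne_zero _ hp.ne_zero⟩
    have hu := isUnit_intCast_zmod_pow (k := k) ha
    have hr : r ≠ 0 := primePowRed_intCast_ne_zero hk ha
    have e1 := nonrootCount_add_rootCount hr
    have e2 := nonrootCount_add_rootCount (neg_ne_zero.2 hr)
    have hneg : primePowRed p hk (-(a : ZMod (p ^ k))) = -r := map_neg _ _
    rcases h with ⟨h0, h2, hk2⟩ | ⟨h2, h0, hk1⟩
    -- If `a` is a nonresidue, sums lose modulo `p`. Modulo `p ^ 2` the singular sums of `-a`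
    -- collapse to at most two, so the regular parts decide: `p (p - 1)` against `p (p - 3) + 4`.
    · have hL := nonrootCount_le_two_mul_ncard hk hu
      have hU := two_mul_ncard_le_of_eq_two hk hk2 hu.neg
      rw [hneg, ← Int.cast_neg] at hU
      change _ ≤ 2 * hypCount (p ^ k) a at hL
      change 2 * hypCount (p ^ k) (-a) ≤ _ at hU
      have hpe : p ^ (k - 1) = p := by simp [hk2]
      rw [hpe, show nonrootCount p r = p - 1 by omega] at hL
      rw [h2, show nonrootCount p (-r) = p - 3 by omega] at hU
      have hLR : (p : ℝ) * (p - 1) ≤ 2 * hypCount (p ^ k) a := by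
        have := (Nat.cast_le (α := ℝ)).2 hL
        rw [Nat.cast_mul, Nat.cast_mul, Nat.cast_sub (by omega)] at this
        simpa using this
      have hUR : 2 * (hypCount (p ^ k) (-a) : ℝ) ≤ p * (p - 3) + 4 := by
        have := (Nat.cast_le (α := ℝ)).2 hU
        rw [Nat.cast_mul, Nat.cast_add, Nat.cast_mul, Nat.cast_sub (by omega)] at this
        norm_num at this
        exact this
      have h1 : (1 + 1 / (p : ℝ)) * (p * (p - 3) + 4) ≤ p * (p - 1) := by
        have e : (1 + 1 / (p : ℝ)) * (p * (p - 3) + 4) = p * (p - 3) + 4 + (p - 3) + 4 / p := by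
          field_simp; ring
        have : 4 / (p : ℝ) ≤ 1 := by rw [div_le_one hp0]; linarith
        rw [e]; nlinarith
      have h3 : (1 + 1 / (p : ℝ)) * (2 * (hypCount (p ^ k) (-a) : ℝ))
          ≤ (1 + 1 / (p : ℝ)) * (p * (p - 3) + 4) := by gcongr
      linarith
    -- If `a` is a residue, `k = 1` suffices: doubled counts at least `p + 1` against at most `p -
    -- 1`.
    · have hL := le_two_mul_ncard_of_eq_one hk hk1 hu
      have hU := two_mul_ncard_le_pow_mul hk hu.neg
      rw [hneg, ← Int.cast_neg] at hU
      change _ ≤ 2 * hypCount (p ^ k) a at hL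
      change 2 * hypCount (p ^ k) (-a) ≤ _ at hU
      have hpe : p ^ (k - 1) = 1 := by simp [hk1]
      rw [show primePowRed p hk (a : ZMod (p ^ k)) = r from rfl, h2,
        show nonrootCount p r = p - 3 by omega] at hL
      rw [hpe, h0, show nonrootCount p (-r) = p - 1 by omega] at hU
      have hL' : p + 1 ≤ 2 * hypCount (p ^ k) a := by omega
      have hU' : 2 * hypCount (p ^ k) (-a) + 1 ≤ p := by omega
      have hLR : (p : ℝ) + 1 ≤ 2 * hypCount (p ^ k) a := by exact_mod_cast hL'
      have hUR : 2 * (hypCount (p ^ k) (-a) : ℝ) + 1 ≤ p := by exact_mod_cast hU'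
      have h3 : (1 + 1 / (p : ℝ)) * (2 * (hypCount (p ^ k) (-a) : ℝ)) ≤ (1 + 1 / (p : ℝ)) * p := by
        gcongr; linarith
      have h4 : (1 + 1 / (p : ℝ)) * p = p + 1 := by field_simp
      linarith
  have hcast : ∀ k : ℕ, ∀ hk : k ≠ 0, primePowRed p hk (a : ZMod (p ^ k)) = (a : ZMod p) :=
    fun k hk => map_intCast _ _
  rcases rootCount_neg h4 (isUnit_intCast_zmod ha).ne_zero with ⟨h, h'⟩ | ⟨h, h'⟩
  · exact ⟨2, two_ne_zero, main 2 two_ne_zero (Or.inl ⟨by rw [hcast]; exact h,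
      by rw [hcast]; exact h', rfl⟩)⟩
  · exact ⟨1, one_ne_zero, main 1 one_ne_zero (Or.inr ⟨by rw [hcast]; exact h,
      by rw [hcast]; exact h', rfl⟩)⟩

/-- Ratios beyond any bound, at moduli beyond any bound. -/
lemma exists_hypCount_ge {a : ℤ} (ha : a ≠ 0) (N : ℕ) (M : ℝ) :
    ∃ n : ℕ, N ≤ n ∧ IsCoprime a (n : ℤ) ∧ M * hypCount n (-a) ≤ hypCount n a := by
  -- Primes beyond `N + 7 + |a|` ensure `N ≤ n`, the range of the local bound, and coprimality to
  -- `a`; `max M 1` forces `T` to be nonempty.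
  obtain ⟨T, hT, hsum⟩ := exists_finset_primes_sum_inv_ge (N + 7 + a.natAbs) (max M 1)
  have hcop : ∀ p ∈ T, IsCoprime a (p : ℤ) := by
    intro p hp
    obtain ⟨hpp, -, hlt⟩ := hT p hp
    rw [Int.isCoprime_iff_gcd_eq_one, Int.gcd_comm]
    refine (Nat.Prime.coprime_iff_not_dvd hpp).2 fun hd => ?_
    have := Nat.le_of_dvd (Int.natAbs_pos.2 ha) hd
    omega
  have key : ∀ S ⊆ T, ∃ n : ℕ, n ≠ 0 ∧ n.primeFactors = S ∧ IsCoprime a (n : ℤ) ∧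
      (1 + ∑ p ∈ S, 1 / (p : ℝ)) * hypCount n (-a) ≤ hypCount n a := by
    intro S
    induction S using Finset.induction_on with
    | empty =>
      intro _
      refine ⟨1, one_ne_zero, by simp, by simpa using isCoprime_one_right, ?_⟩
      have h1 := hypCount_pos one_ne_zero a
      have h2 := hypCount_le one_ne_zero (-a)
      simpa using (by exact_mod_cast h2.trans h1 : (hypCount 1 (-a) : ℝ) ≤ hypCount 1 a)
    | insert p S hpS ih =>
      intro hS
      obtain ⟨n, hn, hnS, hna, hle⟩ := ih fun q hq => hS (Finset.mem_insert_of_mem hq)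
      have hpT := hS (Finset.mem_insert_self p S)
      obtain ⟨hpp, h4, hlt⟩ := hT p hpT
      obtain ⟨k, hk, hkle⟩ := exists_prime_pow_le_hypCount hpp h4 (by omega) (hcop p hpT)
      have hpn : (p ^ k).Coprime n := by
        refine Nat.Coprime.pow_left k ((Nat.Prime.coprime_iff_not_dvd hpp).2 fun hd => hpS ?_)
        rw [← hnS]
        exact Nat.mem_primeFactors.2 ⟨hpp, hd, hn⟩
      refine ⟨p ^ k * n, mul_ne_zero (pow_ne_zero _ hpp.ne_zero) hn, ?_, ?_, ?_⟩
      · rw [hpn.primeFactors_mul, Nat.primeFactors_prime_pow hk hpp, hnS]; rfl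
      · push_cast
        exact ((hcop p hpT).pow_right).mul_right hna
      · rw [hypCount_mul hpn, hypCount_mul hpn, Finset.sum_insert hpS]
        push_cast
        have hs0 : 0 ≤ ∑ q ∈ S, 1 / (q : ℝ) := Finset.sum_nonneg fun q _ => by positivity
        calc (1 + (1 / (p : ℝ) + ∑ q ∈ S, 1 / (q : ℝ))) * (hypCount (p ^ k) (-a) * hypCount n (-a))
            ≤ ((1 + 1 / (p : ℝ)) * (1 + ∑ q ∈ S, 1 / (q : ℝ)))
                * (hypCount (p ^ k) (-a) * hypCount n (-a)) := by
              gcongr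
              have : 0 ≤ 1 / (p : ℝ) * ∑ q ∈ S, 1 / (q : ℝ) := by positivity
              linarith
          _ = ((1 + 1 / (p : ℝ)) * hypCount (p ^ k) (-a))
                * ((1 + ∑ q ∈ S, 1 / (q : ℝ)) * hypCount n (-a)) := by ring
          _ ≤ _ := mul_le_mul hkle hle (by positivity) (by positivity)
  obtain ⟨n, hn, hnT, hna, hle⟩ := key T subset_rfl
  refine ⟨n, ?_, hna, le_trans ?_ hle⟩
  · have hne : T.Nonempty := by
      rw [Finset.nonempty_iff_ne_empty]
      rintro rfl
      rw [Finset.sum_empty] at hsum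
      linarith [le_max_right M 1]
    obtain ⟨p, hp⟩ := hne
    have h1 := Nat.le_of_dvd (Nat.pos_of_ne_zero hn)
      (Nat.mem_primeFactors.1 (hnT ▸ hp)).2.1
    have := (hT p hp).2.2
    omega
  · gcongr
    linarith [le_max_left M 1]

end LocalBounds

/-! ### The global `log log` bound, and passage to unreduced sets and limits. -/

section Assembly

open Finset

lemma log_two_mul_card_primeFactors_le {n : ℕ} (hn : n ≠ 0) :
    Real.log 2 * n.primeFactors.card ≤ Real.log n := by
  have h1 : 2 ^ n.primeFactors.card ≤ n := by
    calc 2 ^ n.primeFactors.card = ∏ _p ∈ n.primeFactors, 2 := by rw [prod_const]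
      _ ≤ ∏ p ∈ n.primeFactors, p :=
        prod_le_prod' fun p hp => (Nat.prime_of_mem_primeFactors hp).two_le
      _ ≤ n := Nat.le_of_dvd (Nat.pos_of_ne_zero hn) (Nat.prod_primeFactors_dvd n)
  have h2 : ((2 : ℝ) ^ n.primeFactors.card) ≤ n := by exact_mod_cast h1
  have h3 := Real.log_le_log (by positivity) h2
  rwa [Real.log_pow, mul_comm] at h3

lemma one_lt_log_three : 1 < Real.log 3 := by
  rw [Real.lt_log_iff_exp_lt (by norm_num)]
  linarith [Real.exp_one_lt_d9]

lemma exp_sum_localWeight_le : ∃ C : ℝ, 0 < C ∧ ∀ n : ℕ, 3 ≤ n →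
    Real.exp (∑ p ∈ n.primeFactors, localWeight p) ≤ C * Real.log (Real.log n) := by
  obtain ⟨C, hC⟩ := sum_recipWeight_le
  have hs : Summable fun m : ℕ => 1 / (m : ℝ) ^ 2 := Real.summable_one_div_nat_pow.2 one_lt_two
  set K := ∑' m : ℕ, 1 / (m : ℝ) ^ 2
  have hl2 : 0 < Real.log 2 := Real.log_pos one_lt_two
  have hl3 := one_lt_log_three
  have hll3 : 0 < Real.log (Real.log 3) := Real.log_pos hl3
  -- The last factor absorbs the additive `log 3` coming from `N ≤ 3 * log n` into a multiple of
  -- `log log n ≥ log log 3 > 0`.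
  refine ⟨Real.exp (20 + C + 2 / Real.log 2 + 12 * K) * (Real.log 3 / Real.log (Real.log 3) + 1),
    by positivity, fun n hn => ?_⟩
  have hL : Real.log 3 ≤ Real.log n := Real.log_le_log (by norm_num) (by exact_mod_cast hn)
  set L := Real.log n with hLdef
  -- The cutoff is about `log n`: smaller primes are handled by Mertens, and each of the at most `L
  -- / log 2` larger ones contributes at most `2 / N ≤ 2 / L`.
  set N := ⌊L⌋₊ + 2 with hN
  have hLN : L ≤ N := by
    have := Nat.lt_floor_add_one L
    push_cast [hN]; linarith
  have hNL : (N : ℝ) ≤ 3 * L := by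
    have := Nat.floor_le (by linarith : 0 ≤ L)
    push_cast [hN]; linarith
  have hN0 : (0 : ℝ) < N := by linarith
  have h1 : ∑ p ∈ n.primeFactors, (if p ≤ 3 then (5 : ℝ) else 0) ≤ 20 := by
    rw [← sum_filter, sum_const, nsmul_eq_mul]
    have : #{p ∈ n.primeFactors | p ≤ 3} ≤ 4 := by
      refine (card_le_card (t := range 4) fun p hp => ?_).trans (by simp)
      rw [mem_filter] at hp
      exact mem_range.2 (by omega)
    have : (#{p ∈ n.primeFactors | p ≤ 3} : ℝ) ≤ 4 := by exact_mod_cast this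
    linarith
  have h2 : ∑ p ∈ n.primeFactors, 12 / (p : ℝ) ^ 2 ≤ 12 * K := by
    have := hs.sum_le_tsum n.primeFactors fun m _ => by positivity
    calc _ = 12 * ∑ p ∈ n.primeFactors, 1 / (p : ℝ) ^ 2 := by
          rw [mul_sum]; exact sum_congr rfl fun p _ => by ring
      _ ≤ _ := by gcongr
  have h3 : ∑ p ∈ n.primeFactors, recipWeight p ≤ Real.log (Real.log N) + C + 2 / Real.log 2 := by
    rw [← sum_filter_add_sum_filter_not n.primeFactors (fun p => p ≤ N)]
    have ha : ∑ p ∈ n.primeFactors with p ≤ N, recipWeight p ≤ Real.log (Real.log N) + C := by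
      refine le_trans (sum_le_sum_of_subset_of_nonneg (fun p hp => ?_)
        fun p _ _ => recipWeight_nonneg p) (hC N (by omega))
      rw [mem_filter] at hp
      exact mem_Ioc.2 ⟨(Nat.prime_of_mem_primeFactors hp.1).pos, hp.2⟩
    have hb : ∑ p ∈ n.primeFactors with ¬ p ≤ N, recipWeight p ≤ 2 / Real.log 2 := by
      calc _ ≤ ∑ p ∈ n.primeFactors with ¬ p ≤ N, 2 / (N : ℝ) := by
            refine sum_le_sum fun p hp => ?_
            rw [mem_filter, not_le] at hp
            have : (N : ℝ) < p := by exact_mod_cast hp.2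
            unfold recipWeight
            split_ifs
            · gcongr
            · positivity
        _ ≤ ∑ p ∈ n.primeFactors, 2 / (N : ℝ) :=
          sum_le_sum_of_subset_of_nonneg (filter_subset _ _) fun _ _ _ => by positivity
        _ = n.primeFactors.card * (2 / N) := by rw [sum_const, nsmul_eq_mul]
        _ ≤ 2 / Real.log 2 := by
          have := log_two_mul_card_primeFactors_le (n := n) (by omega)
          rw [← mul_div_assoc, div_le_div_iff₀ hN0 hl2]
          nlinarith
    linarith
  have hsum : ∑ p ∈ n.primeFactors, localWeight p
      ≤ (20 + C + 2 / Real.log 2 + 12 * K) + Real.log (Real.log N) := by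
    unfold localWeight
    rw [sum_add_distrib, sum_add_distrib]
    linarith
  have hlogN : 0 < Real.log N := Real.log_pos (by linarith)
  have hlN : Real.log N ≤ (Real.log 3 / Real.log (Real.log 3) + 1) * Real.log L := by
    have e1 : Real.log N ≤ Real.log 3 + Real.log L := by
      rw [← Real.log_mul (by norm_num) (by linarith)]
      exact Real.log_le_log hN0 hNL
    have e2 : Real.log (Real.log 3) ≤ Real.log L := Real.log_le_log (by linarith) hL
    have e3 : Real.log 3 ≤ Real.log 3 / Real.log (Real.log 3) * Real.log L := by
      rw [div_mul_eq_mul_div, le_div_iff₀ hll3]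
      gcongr
    linarith
  calc Real.exp (∑ p ∈ n.primeFactors, localWeight p)
      ≤ Real.exp ((20 + C + 2 / Real.log 2 + 12 * K) + Real.log (Real.log N)) :=
        Real.exp_le_exp.2 hsum
    _ = Real.exp (20 + C + 2 / Real.log 2 + 12 * K) * Real.log N := by
        rw [Real.exp_add, Real.exp_log hlogN]
    _ ≤ Real.exp (20 + C + 2 / Real.log 2 + 12 * K)
          * ((Real.log 3 / Real.log (Real.log 3) + 1) * Real.log L) := by gcongr
    _ = _ := by ring

lemma redRatio_bounds (a : ℤ) : ∃ C : ℝ, 0 < C ∧ ∀ n : ℕ, 3 ≤ n → IsCoprime a (n : ℤ) →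
    1 / Real.log (Real.log n) ≤ C * redRatio a n ∧
      redRatio a n ≤ C * Real.log (Real.log n) := by
  obtain ⟨C, hC0, hC⟩ := exp_sum_localWeight_le
  refine ⟨C, hC0, fun n hn ha => ?_⟩
  have hn0 : n ≠ 0 := by omega
  have h1 := hypCount_le_exp_sum n hn0 ha
  have h2 := hypCount_le_exp_sum n hn0 ha.neg_left
  rw [neg_neg] at h2
  have hE := hC n hn
  have hp : (0 : ℝ) < hypCount n a := by exact_mod_cast hypCount_pos hn0 a
  have hm : (0 : ℝ) < hypCount n (-a) := by exact_mod_cast hypCount_pos hn0 (-a)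
  -- Positivity comes for free, since `C * log log n` dominates an exponential.
  have hll : 0 < Real.log (Real.log n) :=
    pos_of_mul_pos_right ((Real.exp_pos _).trans_le hE) hC0.le
  rw [redRatio_eq (by omega) ha]
  constructor
  · rw [← mul_div_assoc, div_le_div_iff₀ hll hm, one_mul]
    refine h2.trans ?_
    calc _ ≤ C * Real.log (Real.log n) * hypCount n a := by gcongr
      _ = _ := by ring
  · rw [div_le_iff₀ hm]
    exact h1.trans (by gcongr)

/-- An integer set in an interval of length `2 n` loses at most a factor two modulo `n`. -/
lemma card_le_two_mul_card_image_intCast {n : ℕ} (s : Finset ℤ) (b : ℤ)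
    (hs : s ⊆ Ico b (b + 2 * n)) : s.card ≤ 2 * (s.image fun t : ℤ => (t : ZMod n)).card := by
  have hinj : ∀ c : ℤ, #{t ∈ s | c ≤ t ∧ t < c + n}
      ≤ (s.image fun t : ℤ => (t : ZMod n)).card := by
    intro c
    rw [← card_image_of_injOn (s := {t ∈ s | c ≤ t ∧ t < c + n})
      (f := fun t : ℤ => (t : ZMod n))]
    · exact card_le_card (image_subset_image (filter_subset _ _))
    · intro x hx y hy hxy
      simp only [coe_filter, Set.mem_ofPred_eq] at hx hy
      have hd := (ZMod.intCast_eq_intCast_iff_dvd_sub x y n).1 hxy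
      have := Int.eq_zero_of_abs_lt_dvd hd (by rw [abs_lt]; constructor <;> omega)
      omega
  have hcover : s ⊆ {t ∈ s | b ≤ t ∧ t < b + n} ∪ {t ∈ s | b + n ≤ t ∧ t < b + n + n} := by
    intro t ht
    have := mem_Ico.1 (hs ht)
    simp only [mem_union, mem_filter, ht, true_and]
    omega
  have h1 := (card_le_card hcover).trans (card_union_le _ _)
  have h2 := hinj b
  have h3 := hinj (b + n)
  omega

lemma image_coordSumset (a : ℤ) (n : ℕ) :
    ((coordSumset a n).image fun t : ℤ => (t : ZMod n)) = redSumset a n := by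
  rw [coordSumset, redSumset, image_image]; rfl

lemma image_coordDiffset (a : ℤ) (n : ℕ) :
    ((coordDiffset a n).image fun t : ℤ => (t : ZMod n)) = redDiffset a n := by
  rw [coordDiffset, redDiffset, image_image]; rfl

lemma card_redSumset_le (a : ℤ) (n : ℕ) : (redSumset a n).card ≤ (coordSumset a n).card := by
  rw [← image_coordSumset]; exact card_image_le

lemma card_redDiffset_le (a : ℤ) (n : ℕ) : (redDiffset a n).card ≤ (coordDiffset a n).card := by
  rw [← image_coordDiffset]; exact card_image_le

lemma card_coordSumset_le (a : ℤ) (n : ℕ) :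
    (coordSumset a n).card ≤ 2 * (redSumset a n).card := by
  rw [← image_coordSumset]
  refine card_le_two_mul_card_image_intCast _ 0 fun t ht => ?_
  obtain ⟨p, hp, rfl⟩ := mem_image.1 ht
  have := (mem_filter.1 hp).1
  simp only [mem_product, mem_Ico] at this ⊢
  omega

lemma card_coordDiffset_le (a : ℤ) (n : ℕ) :
    (coordDiffset a n).card ≤ 2 * (redDiffset a n).card := by
  rw [← image_coordDiffset]
  refine card_le_two_mul_card_image_intCast _ (-n) fun t ht => ?_
  obtain ⟨p, hp, rfl⟩ := mem_image.1 ht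
  have := (mem_filter.1 hp).1
  simp only [mem_product, mem_Ico] at this ⊢
  omega

lemma frequently_coprimeAtTop {a : ℤ} {P : ℕ → Prop}
    (h : ∀ N : ℕ, ∃ n, N ≤ n ∧ 2 ≤ n ∧ IsCoprime a (n : ℤ) ∧ P n) :
    ∃ᶠ n in coprimeAtTop a, P n := by
  rw [coprimeAtTop, Filter.frequently_inf_principal, Filter.frequently_atTop]
  intro N
  obtain ⟨n, h1, h2, h3, h4⟩ := h N
  exact ⟨n, h1, ⟨by omega, h3⟩, h4⟩

lemma limsup_coe_eq_top_of_frequently {f : Filter ℕ} {u : ℕ → ℝ}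
    (h : ∀ M : ℝ, ∃ᶠ n in f, M ≤ u n) : Filter.limsup (fun n => (u n : EReal)) f = ⊤ := by
  rw [EReal.eq_top_iff_forall_lt]
  intro M
  have h1 : ((M + 1 : ℝ) : EReal) ≤ Filter.limsup (fun n => (u n : EReal)) f :=
    Filter.le_limsup_of_frequently_le ((h (M + 1)).mono fun n hn => EReal.coe_le_coe_iff.2 hn)
  exact lt_of_lt_of_le (EReal.coe_lt_coe_iff.2 (by linarith)) h1

lemma liminf_coe_eq_zero_of_frequently {f : Filter ℕ} {u : ℕ → ℝ} (h0 : ∀ n, 0 ≤ u n)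
    (h : ∀ ε : ℝ, 0 < ε → ∃ᶠ n in f, u n ≤ ε) :
    Filter.liminf (fun n => (u n : EReal)) f = 0 := by
  refine le_antisymm ?_ ?_
  · refine le_of_forall_gt_imp_ge_of_dense fun c hc => ?_
    obtain ⟨ε, hε0, hεc⟩ := EReal.lt_iff_exists_real_btwn.1 hc
    refine le_trans (Filter.liminf_le_of_frequently_le
      ((h ε (EReal.coe_pos.1 hε0)).mono fun n hn => EReal.coe_le_coe_iff.2 hn)) hεc.le
  · exact Filter.le_liminf_of_le
      (h := Filter.Eventually.of_forall fun n => EReal.coe_nonneg.2 (h0 n))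

lemma frequently_le_redRatio {a : ℤ} (ha : a ≠ 0) (M : ℝ) :
    ∃ᶠ n : ℕ in coprimeAtTop a, 2 ≤ n ∧ IsCoprime a (n : ℤ) ∧ M ≤ redRatio a n := by
  refine frequently_coprimeAtTop fun N => ?_
  obtain ⟨n, hN, hna, hle⟩ := exists_hypCount_ge ha (N + 2) M
  have hm : (0 : ℝ) < hypCount n (-a) := by exact_mod_cast hypCount_pos (by omega) (-a)
  refine ⟨n, by omega, by omega, hna, by omega, hna, ?_⟩
  rwa [redRatio_eq (by omega) hna, le_div_iff₀ hm]

lemma frequently_redRatio_le {a : ℤ} (ha : a ≠ 0) {ε : ℝ} (hε : 0 < ε) :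
    ∃ᶠ n : ℕ in coprimeAtTop a, 2 ≤ n ∧ IsCoprime a (n : ℤ) ∧ redRatio a n ≤ ε := by
  refine frequently_coprimeAtTop fun N => ?_
  -- Passing to `-a` exchanges sums and differences, so a ratio at least `ε⁻¹` becomes one at most
  -- `ε`.
  obtain ⟨n, hN, hna, hle⟩ := exists_hypCount_ge (neg_ne_zero.2 ha) (N + 2) ε⁻¹
  have hna' : IsCoprime a (n : ℤ) := by simpa using hna.neg_left
  have hm : (0 : ℝ) < hypCount n (-a) := by exact_mod_cast hypCount_pos (by omega) (-a)
  rw [neg_neg] at hle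
  refine ⟨n, by omega, by omega, hna', by omega, hna', ?_⟩
  rw [redRatio_eq (by omega) hna', div_le_iff₀ hm]
  rwa [inv_mul_le_iff₀ hε] at hle

lemma redRatio_nonneg (a : ℤ) (n : ℕ) : 0 ≤ redRatio a n := by unfold redRatio; positivity

lemma unredRatio_nonneg (a : ℤ) (n : ℕ) : 0 ≤ unredRatio a n := by unfold unredRatio; positivity

lemma card_redDiffset_pos {a : ℤ} {n : ℕ} (hn : 2 ≤ n) (h : IsCoprime a (n : ℤ)) :
    0 < (redDiffset a n).card := by
  rw [card_redDiffset hn h]; exact hypCount_pos (by omega) _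

lemma redRatio_le_two_mul_unredRatio {a : ℤ} {n : ℕ} (hn : 2 ≤ n) (h : IsCoprime a (n : ℤ)) :
    redRatio a n ≤ 2 * unredRatio a n := by
  have h0 := card_redDiffset_pos hn h
  have h0' : 0 < (coordDiffset a n).card := h0.trans_le (card_redDiffset_le a n)
  rw [redRatio, unredRatio, ← mul_div_assoc, div_le_div_iff₀ (by exact_mod_cast h0)
    (by exact_mod_cast h0')]
  have h1 := card_redSumset_le a n
  have h2 := card_coordDiffset_le a n
  have h3 := Nat.mul_le_mul h1 h2
  calc ((redSumset a n).card : ℝ) * (coordDiffset a n).card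
      ≤ (coordSumset a n).card * (2 * (redDiffset a n).card) := by exact_mod_cast h3
    _ = _ := by ring

lemma unredRatio_le_two_mul_redRatio {a : ℤ} {n : ℕ} (hn : 2 ≤ n) (h : IsCoprime a (n : ℤ)) :
    unredRatio a n ≤ 2 * redRatio a n := by
  have h0 := card_redDiffset_pos hn h
  have h0' : 0 < (coordDiffset a n).card := h0.trans_le (card_redDiffset_le a n)
  rw [redRatio, unredRatio, ← mul_div_assoc, div_le_div_iff₀ (by exact_mod_cast h0')
    (by exact_mod_cast h0)]
  exact_mod_cast Nat.mul_le_mul (card_coordSumset_le a n) (card_redDiffset_le a n)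

end Assembly

theorem mainTheorem8 (a : ℤ) (ha : a ≠ 0) :
    (∃ C : ℝ, 0 < C ∧ ∀ n : ℕ, 3 ≤ n → IsCoprime a (n : ℤ) →
      1 / Real.log (Real.log n) ≤ C * redRatio a n ∧
        redRatio a n ≤ C * Real.log (Real.log n)) ∧
    (Filter.limsup (fun n : ℕ => (redRatio a n : EReal)) (coprimeAtTop a) = ⊤ ∧
      Filter.liminf (fun n : ℕ => (redRatio a n : EReal)) (coprimeAtTop a) = 0) ∧
    (Filter.limsup (fun n : ℕ => (unredRatio a n : EReal)) (coprimeAtTop a) = ⊤ ∧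
      Filter.liminf (fun n : ℕ => (unredRatio a n : EReal)) (coprimeAtTop a) = 0) := by
  refine ⟨redRatio_bounds a, ⟨?_, ?_⟩, ?_, ?_⟩
  · exact limsup_coe_eq_top_of_frequently fun M =>
      (frequently_le_redRatio ha M).mono fun n hn => hn.2.2
  · exact liminf_coe_eq_zero_of_frequently (redRatio_nonneg a) fun ε hε =>
      (frequently_redRatio_le ha hε).mono fun n hn => hn.2.2
  · refine limsup_coe_eq_top_of_frequently fun M =>
      (frequently_le_redRatio ha (2 * M)).mono fun n ⟨hn, hna, h⟩ => ?_
    linarith [redRatio_le_two_mul_unredRatio hn hna]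
  · refine liminf_coe_eq_zero_of_frequently (unredRatio_nonneg a) fun ε hε =>
      (frequently_redRatio_le ha (half_pos hε)).mono fun n ⟨hn, hna, h⟩ => ?_
    linarith [unredRatio_le_two_mul_redRatio hn hna]
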